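/- Let $p,q\ge 1$ be coprime integers and consider the square lattice on the cylinder $\mathbb Z^2/\mathbb Z(p,q)$, in which every site has its four lattice neighbours (counted with multiplicity). Let $\Sigma$ be the half-infinite cylinder, i.e. the image of $[0,p]\times[0,\infty)\cap\mathbb Z^2$, and let $\partial\Sigma$ be (the image of) any subset of $[0,p]\times[0,q]\cap\mathbb Z^2$; for example $\{(i,j): iq>jp\}$ models the half-plane $\{iq\le jp\}$. The sites of $\Sigma\setminus\partial\Sigma$ are internal, all other sites of the cylinder are sinks. In a toppling at an internal site $v$, $v$ loses four grains and each neighbour of $v$ receives one; it is legal if $v$ holds at least $4$ grains. A state is stable if all internal sites hold at most $3$ grains; a territory of a stable state is a connected component, with at least two vertices, of the full subgraph on the internal sites holding exactly $3$ grains. Sending a wave from a site $v$ in a territory means: add a grain at $v$, topple $v$, then relax by (possibly infinitely many, but locally finitely many) legal topplings at internal sites other than $v$ until all of these sites are stable, and finally remove a grain from $v$. Start from the state with $3$ grains at every internal site, and send $n$ waves from a site $(i_0,N)$, $0\le i_0\le p$. Let $h^{(n)}$ be the total number of topplings at each site and $\phi^{(n)}$ the state obtained. Then there is a constant $C=C_{p,q}$,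 depending only on $p,q$, such that for every $\partial\Sigma$ there is an integer $k=k_{p,q,\partial\Sigma}$ with the following property. For every $n\ge 0$ and all sufficiently large $N$ (depending on $n$), the $n$ waves can be sent, and the defect set $$Def=\{(i,j)\in[0,p]\times[0,\infty)\cap\mathbb Z^2 : h^{(n)}(i,j)\neq\min(pj-qi+k,\,n)\}$$ satisfies $|Def|<C$. Moreover, there is an integer $a$ (depending on $n$) and a decomposition $Def=B\cup E$ with $B\subset[0,p]\times[0,C]$ (boundary artifacts) and $E\subset[0,p]\times[a,a+C]\cap\{|pj-qi+k-n|\le C\}$, a band of bounded width along the line $pj-qi+k=n$ of direction $(p,q)$. All coloured sites (internal sites with $\phi^{(n)}<3$) lie in these two regions $[0,p]\times[0,C]$ and $[0,p]\times[a,a+C]\cap\{|pj-qi+k-n|\le C\}$, those in the second one forming the tracery of the discrete tropical edge. -/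

import Mathlib

namespace WaveCylinder

/-- The infinite periodic cylinder `ℤ² / ℤ(p,q)`. -/
abbrev Cyl (p q : ℕ) : Type :=
  (ℤ × ℤ) ⧸ AddSubgroup.zmultiples (((p : ℤ), (q : ℤ)) : ℤ × ℤ)

variable {p q : ℕ}

/-- The site of the cylinder represented by a lattice point. -/
def site (p q : ℕ) (x : ℤ × ℤ) : Cyl p q := QuotientAddGroup.mk x

/-- The horizontal unit step. -/
def stepX (p q : ℕ) : Cyl p q := site p q (1, 0)

/-- The vertical unit step. -/
def stepY (p q : ℕ) : Cyl p q := site p q (0, 1)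

/-- The nearest-neighbour graph of the cylinder. -/
def cylGraph (p q : ℕ) : SimpleGraph (Cyl p q) :=
  SimpleGraph.fromRel fun v w => w = v + stepX p q ∨ w = v + stepY p q

/-- The lattice points of the half-infinite strip `[0,p] × [0,∞)`. -/
def strip (p : ℕ) : Set (ℤ × ℤ) := {x | 0 ≤ x.1 ∧ x.1 ≤ p ∧ 0 ≤ x.2}

/-- The internal sites of the half-infinite cylinder `Σ` (the image of the strip) with boundary
represented by `S`. All other sites of `ℤ² / ℤ(p,q)` are sinks. -/
def internal (p q : ℕ) (S : Set (ℤ × ℤ)) : Set (Cyl p q) :=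
  (site p q '' strip p) \ (site p q '' S)

/-- Distributions of sand. The values at the sinks only record the lost sand. -/
abbrev State (p q : ℕ) : Type := Cyl p q → ℤ

open Classical in
/-- One grain of sand at `v`. -/
noncomputable def grain (v : Cyl p q) : State p q := fun w => if w = v then 1 else 0

/-- The toppling at `v`: four grains leave `v`, one along each of the four lattice steps (two of
these steps may lead to the same site, which happens for `p = q = 1`). -/
noncomputable def topple (v : Cyl p q) (φ : State p q) : State p q :=
  φ - 4 • grain v + grain (v + stepX p q) + grain (v - stepX p q)
    + grain (v + stepY p q) + grain (v - stepY p q)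

/-- The states along a sequence of topplings; `none` stands for an idle step, so that finite
sequences are covered. -/
noncomputable def run (φ : State p q) (x : ℕ → Option (Cyl p q)) : ℕ → State p q
  | 0 => φ
  | i + 1 => match x i with
    | none => run φ x i
    | some w => topple w (run φ x i)

/-- `φ` is stable on the set `A`. -/
def StableOn (A : Set (Cyl p q)) (φ : State p q) : Prop := ∀ w ∈ A, φ w < 4

/-- `φ` has a locally finite stabilizing relaxation, by legal topplings at vertices of `A` only,
with toppling function `u` and resulting state `ψ`. -/
def Relaxes (A : Set (Cyl p q)) (φ : State p q) (u : Cyl p q → ℕ) (ψ : State p q) : Prop :=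
  ∃ x : ℕ → Option (Cyl p q),
    (∀ i w, x i = some w → w ∈ A ∧ 4 ≤ run φ x i w) ∧
    (∀ w, {i | x i = some w}.Finite ∧ u w = {i | x i = some w}.ncard) ∧
    (∀ w, ∀ᶠ i in Filter.atTop, run φ x i w = ψ w) ∧
    StableOn A ψ

/-- `v` belongs to a territory of `φ`: a connected component, with at least two vertices, of the
full subgraph on the internal sites that carry three grains. -/
def InTerritory (D : Set (Cyl p q)) (φ : State p q) (v : Cyl p q) : Prop :=
  ∃ c : ((cylGraph p q).induce {w | w ∈ D ∧ φ w = 3}).ConnectedComponent,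
    c.supp.Nontrivial ∧ ∃ hv : v ∈ {w | w ∈ D ∧ φ w = 3}, (⟨v, hv⟩ : {w | w ∈ D ∧ φ w = 3}) ∈ c.supp

open Classical in
/-- Sending a wave from a vertex `v` in a territory of a stable state `φ`: add a grain at `v`,
topple `v`, freeze `v`, relax, and remove a grain from `v`. Here `u` counts all topplings made and
`φ'` is the state obtained. -/
def IsWave (D : Set (Cyl p q)) (v : Cyl p q) (φ : State p q) (u : Cyl p q → ℕ)
    (φ' : State p q) : Prop :=
  StableOn D φ ∧ InTerritory D φ v ∧
    ∃ (u₀ : Cyl p q → ℕ) (ψ : State p q),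
      Relaxes (D \ {v}) (topple v (φ + grain v)) u₀ ψ ∧
      (u = fun w => u₀ w + if w = v then 1 else 0) ∧
      φ' = ψ - grain v

open Classical in
/-- The maximal stable state: three grains at each internal site. -/
noncomputable def maximalState (D : Set (Cyl p q)) : State p q := fun w => if w ∈ D then 3 else 0

/-- Starting from the maximal stable state one can send `n` waves from `v`; the total number of
topplings is `h` and the state obtained is `φ`. -/
def Waves (D : Set (Cyl p q)) (v : Cyl p q) : ℕ → (Cyl p q → ℕ) → State p q → Prop
  | 0, h, φ => h = 0 ∧ φ = maximalState D
  | n + 1, h, φ => ∃ (h₀ : Cyl p q → ℕ) (φ₀ : State p q) (u : Cyl p q → ℕ),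
      Waves D v n h₀ φ₀ ∧ IsWave D v φ₀ u φ ∧ h = h₀ + u

/-- The set of points `(i,j)` of the strip where `h` differs from `min (pj - qi + k, n)`. -/
def defectSet (p q : ℕ) (h : Cyl p q → ℕ) (k : ℤ) (n : ℕ) : Set (ℤ × ℤ) :=
  {x | x ∈ strip p ∧ (h (site p q x) : ℤ) ≠ min (p * x.2 - q * x.1 + k) n}

/-- The set of points of the strip that represent coloured sites: internal sites with fewer than
three grains. -/
def coloredSet (p q : ℕ) (D : Set (Cyl p q)) (φ : State p q) : Set (ℤ × ℤ) :=
  {x | x ∈ strip p ∧ site p q x ∈ D ∧ φ (site p q x) < 3}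

/-- The box `[0,p] × [a,b]`. -/
def box (p : ℕ) (a b : ℤ) : Set (ℤ × ℤ) := Set.Icc (0, a) ((p : ℤ), b)

/-- The neighbourhood of width `C` of the line `pj - qi + k = n`. -/
def band (p q : ℕ) (k : ℤ) (n C : ℕ) : Set (ℤ × ℤ) :=
  {x | |(p * x.2 - q * x.1 + k - n : ℤ)| ≤ C}

end WaveCylinder

/-! ### Discrete harmonic functions on `ℤ` with steps `±p` and `±q` -/

namespace WaveCylinder

/-! As `p` and `q` are coprime, the height `pj - qi` identifies the cylinder with `ℤ`, and the
Laplacian becomes `lap`. By the least action principle, `n` waves topple according to the least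
nonnegative function that is superharmonic at the internal sites other than the source and at least
`n` at the source (`Waves.spec`). Comparison with explicit superharmonic functions gives it growth
of slope at most one and a bounded gradient, uniformly in `n`; far out it equals `n`.

The shape comes from a conserved quantity. `lap f` is the second difference of `smear p q f`, so the
first difference of `smear`, the flux, is a nonincreasing integer past the boundary. It ends at `0`,
and the growth bound makes it at most `P = p² + q²` after a bounded distance. On a long interval of
constant flux the gradient is a bounded integer harmonic function, hence constant
(`exists_length_eq_const`); the function is affine with integer slope `d` and flux `P * d`. So the
flux can linger only at `P` and `0`: slope one, a bounded transition, then the constant `n`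
(`exists_profile`).

The offset `k` is independent of `n` because the value at a fixed height is monotone and bounded in
`n`, hence eventually constant. The finitely many remaining `n` and the finitely many boundaries are
absorbed into the constant. -/

/-- The lattice Laplacian in the height coordinate `pj - qi`. -/
def lap (p q : ℕ) (f : ℤ → ℤ) (m : ℤ) : ℤ :=
  f (m + p) + f (m - p) + f (m + q) + f (m - q) - 4 * f m

/-- The convolution of `f` with the square of the indicator of an interval of length `p`. -/
def triangleSum (p : ℕ) (f : ℤ → ℤ) (m : ℤ) : ℤ :=
  ∑ i ∈ Finset.range p, ∑ j ∈ Finset.range p, f (m + j - i)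

/-- A local average of `f` (up to the factor `p² + q²`) whose second difference is `lap f`. -/
def smear (p q : ℕ) (f : ℤ → ℤ) (m : ℤ) : ℤ := triangleSum p f m + triangleSum q f m

lemma triangleSum_succ_sub (p : ℕ) (f : ℤ → ℤ) (m : ℤ) :
    triangleSum p f (m + 1) - triangleSum p f m =
      ∑ i ∈ Finset.range p, (f (m + p - i) - f (m - i)) := by
  unfold triangleSum
  rw [← Finset.sum_sub_distrib]
  refine Finset.sum_congr rfl fun i _ => ?_
  rw [← Finset.sum_sub_distrib]
  have := Finset.sum_range_sub (fun j : ℕ => f (m + j - i)) p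
  simp only [Nat.cast_zero, add_zero] at this
  rw [← this]
  refine Finset.sum_congr rfl fun j _ => ?_
  push_cast
  rw [show m + 1 + (j : ℤ) - i = m + (j + 1) - i by ring]

/-- The double sum telescopes once in each index: the triangular kernel has second difference `δ_p -
2δ_0 + δ_{-p}`. -/
lemma triangleSum_second_difference (p : ℕ) (f : ℤ → ℤ) (m : ℤ) :
    triangleSum p f (m + 1) - 2 * triangleSum p f m + triangleSum p f (m - 1) =
      f (m + p) + f (m - p) - 2 * f m := by
  have h1 := triangleSum_succ_sub p f m
  have h2 := triangleSum_succ_sub p f (m - 1)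
  rw [sub_add_cancel] at h2
  have h3 := Finset.sum_range_sub' (fun i : ℕ => f (m + p - i) - f (m - i)) p
  rw [Finset.sum_sub_distrib] at h3
  have h4 : ∑ i ∈ Finset.range p, (f (m + p - (i + 1 : ℕ)) - f (m - (i + 1 : ℕ))) =
      ∑ i ∈ Finset.range p, (f (m - 1 + p - i) - f (m - 1 - i)) := by
    refine Finset.sum_congr rfl fun i _ => ?_
    push_cast
    rw [show m + (p : ℤ) - (i + 1) = m - 1 + p - i by ring,
      show m - ((i : ℤ) + 1) = m - 1 - i by ring]
  rw [h4, ← h1, ← h2] at h3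
  simp only [Nat.cast_zero, sub_zero, add_sub_cancel_right] at h3
  linarith

lemma smear_second_difference (p q : ℕ) (f : ℤ → ℤ) (m : ℤ) :
    smear p q f (m + 1) - 2 * smear p q f m + smear p q f (m - 1) = lap p q f m := by
  have h1 := triangleSum_second_difference p f m
  have h2 := triangleSum_second_difference q f m
  unfold smear lap
  linarith

lemma smear_succ_sub (p q : ℕ) (f : ℤ → ℤ) (m : ℤ) :
    smear p q f (m + 1) - smear p q f m = smear p q (fun x => f (x + 1) - f x) m := by
  simp only [smear, triangleSum, Finset.sum_sub_distrib]
  simp only [show ∀ i j : ℕ, m + 1 + (j : ℤ) - i = m + j - i + 1 from fun i j => by ring]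
  ring

lemma triangleSum_le (p : ℕ) (f : ℤ → ℤ) (m B : ℤ)
    (h : ∀ x, m - p < x → x < m + p → f x ≤ B) : triangleSum p f m ≤ p * p * B := by
  unfold triangleSum
  calc _ ≤ ∑ i ∈ Finset.range p, ∑ j ∈ Finset.range p, B := by
        refine Finset.sum_le_sum fun i hi => Finset.sum_le_sum fun j hj => h _ ?_ ?_ <;>
          · simp only [Finset.mem_range] at hi hj
            omega
    _ = _ := by simp [mul_assoc]

lemma smear_le (p q : ℕ) (f : ℤ → ℤ) (m B : ℤ)
    (h : ∀ x, m - (p + q) < x → x < m + (p + q) → f x ≤ B) :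
    smear p q f m ≤ (p * p + q * q) * B := by
  have h1 := triangleSum_le p f m B fun x _ _ => h x (by omega) (by omega)
  have h2 := triangleSum_le q f m B fun x _ _ => h x (by omega) (by omega)
  unfold smear
  linarith

lemma smear_neg (p q : ℕ) (f : ℤ → ℤ) (m : ℤ) :
    smear p q (fun x => - f x) m = - smear p q f m := by
  simp only [smear, triangleSum, Finset.sum_neg_distrib]
  ring

lemma le_smear (p q : ℕ) (f : ℤ → ℤ) (m B : ℤ)
    (h : ∀ x, m - (p + q) < x → x < m + (p + q) → B ≤ f x) :
    (p * p + q * q) * B ≤ smear p q f m := by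
  have := smear_le p q (fun x => - f x) m (-B) fun x h1 h2 => neg_le_neg (h x h1 h2)
  rw [smear_neg] at this
  linarith

lemma smear_eq (p q : ℕ) (f : ℤ → ℤ) (m B : ℤ)
    (h : ∀ x, m - (p + q) < x → x < m + (p + q) → f x = B) :
    smear p q f m = (p * p + q * q) * B :=
  le_antisymm (smear_le p q f m B fun x h1 h2 => (h x h1 h2).le)
    (le_smear p q f m B fun x h1 h2 => (h x h1 h2).ge)

lemma exists_mul_eq_mul_add_one {p q : ℕ} (hp : 0 < p) (hq : 0 < q) (hpq : Nat.Coprime p q) :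
    ∃ s t : ℕ, s * p = t * q + 1 := by
  have h := Nat.gcd_eq_gcd_ab p q
  rw [hpq.gcd_eq_one] at h
  set x := Nat.gcdA p q
  set y := Nat.gcdB p q
  have hp' : (1 : ℤ) ≤ p := by exact_mod_cast hp
  have hq' : (1 : ℤ) ≤ q := by exact_mod_cast hq
  -- Shifting the Bézout coefficients by a large multiple of `(q, -p)` gives both the required sign.
  have e1 : 0 ≤ x + q * (|x| + |y|) := by
    nlinarith [neg_abs_le x, abs_nonneg x, abs_nonneg y]
  have e2 : 0 ≤ -y + p * (|x| + |y|) := by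
    nlinarith [le_abs_self y, abs_nonneg x, abs_nonneg y]
  obtain ⟨s, hs⟩ := Int.eq_ofNat_of_zero_le e1
  obtain ⟨t, ht⟩ := Int.eq_ofNat_of_zero_le e2
  refine ⟨s, t, ?_⟩
  zify
  rw [← hs, ← ht]
  push_cast at h
  linear_combination -h

/-- A predicate on a half-line that propagates along the steps `p` and `-q` inside the half-line
propagates along the unit step. -/
lemma step_of_propagates {p q s t : ℕ} (hst : s * p = t * q + 1) (Q : ℤ → Prop) (x : ℤ)
    (hup : ∀ y, x ≤ y → y < x + s * p → Q y → Q (y + p))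
    (hdown : ∀ y, x + q < y → y ≤ x + s * p → Q y → Q (y - q)) (hx : Q x) : Q (x + 1) := by
  rcases Nat.eq_zero_or_pos p with rfl | hp
  · simp at hst
  -- Climb `s` steps of `p`, then descend `t` steps of `q`; the path never goes below `x`.
  have h1 : ∀ i : ℕ, i ≤ s → Q (x + i * p) := by
    intro i
    induction i with
    | zero => intro _; simpa using hx
    | succ i ih =>
      intro hi
      have := hup (x + i * p) (le_add_of_nonneg_right (by positivity)) ?_ (ih (by omega))
      · convert this using 1
        push_cast; ring
      · have : ((i : ℤ) + 1) * p ≤ s * p := by gcongr; exact_mod_cast hi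
        have : (0 : ℤ) < p := by exact_mod_cast hp
        linarith
  have hst' : (s : ℤ) * p = t * q + 1 := by exact_mod_cast hst
  have h2 : ∀ i : ℕ, i ≤ t → Q (x + s * p - i * q) := by
    intro i
    induction i with
    | zero => intro _; simpa using h1 s le_rfl
    | succ i ih =>
      intro hi
      have h0 : (0 : ℤ) ≤ i * q := by positivity
      have h3 : ((i : ℤ) + 1) * q ≤ t * q := by gcongr; exact_mod_cast hi
      have := hdown (x + s * p - i * q) (by linarith) (by linarith) (ih (by omega))
      convert this using 1
      push_cast; ring
  convert h2 t le_rfl using 1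
  linarith

/-- The square of a harmonic function is subharmonic, and its Laplacian is the local Dirichlet
energy, which vanishes only if `g` is locally constant along the steps. -/
lemma lap_sq {p q : ℕ} {g : ℤ → ℤ} {m : ℤ} (h : lap p q g m = 0) :
    lap p q (fun x => g x ^ 2) m = (g (m + p) - g m) ^ 2 + (g (m - p) - g m) ^ 2 +
      (g (m + q) - g m) ^ 2 + (g (m - q) - g m) ^ 2 := by
  unfold lap at h ⊢
  linear_combination (2 * g m) * h

lemma eq_of_lap_sq_eq_zero {p q : ℕ} {g : ℤ → ℤ} {m : ℤ} (h : lap p q g m = 0)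
    (h' : lap p q (fun x => g x ^ 2) m = 0) :
    g (m + p) = g m ∧ g (m - p) = g m ∧ g (m + q) = g m ∧ g (m - q) = g m := by
  rw [lap_sq h] at h'
  have h1 := sq_nonneg (g (m + p) - g m)
  have h2 := sq_nonneg (g (m - p) - g m)
  have h3 := sq_nonneg (g (m + q) - g m)
  have h4 := sq_nonneg (g (m - q) - g m)
  refine ⟨?_, ?_, ?_, ?_⟩ <;>
    exact sub_eq_zero.mp (pow_eq_zero_iff (two_ne_zero)|>.mp (by linarith))

/-- Unique continuation for harmonic functions. -/
lemma eq_const_of_lap_eq_zero {p q : ℕ} (hp : 0 < p) (hq : 0 < q) {g : ℤ → ℤ} {a b x c : ℤ}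
    (hg : ∀ m, a ≤ m → m ≤ b → lap p q g m = 0) (hax : a ≤ x) (hxb : x + 2 * (p + q) ≤ b)
    (hx : ∀ m, x ≤ m → m ≤ x + 2 * (p + q) → g m = c) :
    ∀ m, a ≤ m → m ≤ b → g m = c := by
  -- With `p` the larger step, harmonicity at `m` determines `g (m + p)` from the `2 * p` preceding
  -- values, and likewise `g (m - p)`. For `p = q` the extreme value occurs twice.
  wlog hle : q ≤ p generalizing p q
  · refine this hq hp (fun m h1 h2 => ?_) (by linarith) (fun m h1 h2 => hx m h1 (by linarith))
      (by omega)
    have := hg m h1 h2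
    unfold lap at this ⊢
    linarith
  have right : ∀ k : ℕ, x + k ≤ b → g (x + k) = c := by
    intro k
    induction k using Nat.strong_induction_on with
    | _ k ih =>
      intro hk
      by_cases hk' : k ≤ 2 * (p + q)
      · exact hx _ (by omega) (by omega)
      have h0 := hg (x + k - p) (by omega) (by omega)
      have key : ∀ d : ℕ, 0 < d → d ≤ 2 * p → g (x + k - d) = c := fun d h1 h2 => by
        have := ih (k - d) (by omega) (by omega)
        rwa [Nat.cast_sub (by omega), ← add_sub_assoc] at this
      have e1 := key p hp (by omega)
      have e2 := key (p + p) (by omega) (by omega)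
      have e3 := key (p + q) (by omega) (by omega)
      push_cast at e2 e3
      unfold lap at h0
      rw [sub_add_cancel, e1, show x + (k : ℤ) - p - p = x + k - (p + p) by ring, e2,
        show x + (k : ℤ) - p - q = x + k - (p + q) by ring, e3] at h0
      rcases hle.eq_or_lt with rfl | hlt
      · rw [sub_add_cancel] at h0
        linarith
      · have e4 := key (p - q) (by omega) (by omega)
        rw [Nat.cast_sub hle] at e4
        rw [show x + (k : ℤ) - p + q = x + k - (p - q) by ring, e4] at h0
        linarith
  have left : ∀ k : ℕ, a ≤ x - k → g (x - k) = c := by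
    intro k
    induction k using Nat.strong_induction_on with
    | _ k ih =>
      intro hk
      rcases Nat.eq_zero_or_pos k with rfl | hk'
      · exact hx _ (by omega) (by omega)
      have h0 := hg (x - k + p) (by omega) (by omega)
      have key : ∀ d : ℕ, 0 < d → d ≤ 2 * p → g (x - k + d) = c := fun d h1 h2 => by
        by_cases hd : d ≤ k
        · have := ih (k - d) (by omega) (by omega)
          rwa [Nat.cast_sub hd, show x - ((k : ℤ) - d) = x - k + d by ring] at this
        · exact hx _ (by omega) (by omega)
      have e1 := key p hp (by omega)
      have e2 := key (p + p) (by omega) (by omega)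
      have e3 := key (p + q) (by omega) (by omega)
      push_cast at e2 e3
      unfold lap at h0
      rw [add_sub_cancel_right, e1, show x - (k : ℤ) + p + p = x - k + (p + p) by ring, e2,
        show x - (k : ℤ) + p + q = x - k + (p + q) by ring, e3] at h0
      rcases hle.eq_or_lt with rfl | hlt
      · rw [add_sub_cancel_right] at h0
        linarith
      · have e4 := key (p - q) (by omega) (by omega)
        rw [Nat.cast_sub hle] at e4
        rw [show x - (k : ℤ) + p - q = x - k + (p - q) by ring, e4] at h0
        linarith
  intro m h1 h2
  rcases le_total x m with h | h
  · have := right (m - x).toNat (by omega)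
    rwa [Int.toNat_of_nonneg (by omega), add_sub_cancel] at this
  · have := left (x - m).toNat (by omega)
    rwa [Int.toNat_of_nonneg (by omega), sub_sub_cancel] at this

/-- A bounded integer-valued function that is harmonic on a long interval is constant there. -/
lemma exists_length_eq_const {p q : ℕ} (hp : 0 < p) (hq : 0 < q) (hpq : Nat.Coprime p q) (G : ℕ) :
    ∃ R : ℕ, ∀ (g : ℤ → ℤ) (a b : ℤ), (∀ m, |g m| ≤ G) →
      (∀ m, a ≤ m → m ≤ b → lap p q g m = 0) → a + R ≤ b →
      ∀ m, a ≤ m → m ≤ b → g m = g a := by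
  obtain ⟨s, t, hst⟩ := exists_mul_eq_mul_add_one hp hq hpq
  -- A block has room for a Bézout excursion of length `s * p` and for the window of length `2 * (p
  -- + q)` that unique continuation needs.
  set l : ℕ := s * p + 2 * (p + q) + 1 with hl
  set r : ℕ := 2 * ((p * p + q * q) * G ^ 2) + 1 with hr
  refine ⟨(r + 1) * l, fun g a b hG hg hab => ?_⟩
  set V : ℤ → ℤ := fun m => smear p q (fun x => g x ^ 2) (m + 1) - smear p q (fun x => g x ^ 2) m
    with hV
  have hsq : ∀ x, g x ^ 2 ≤ (G : ℤ) ^ 2 := fun x =>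
    sq_le_sq' (abs_le.mp (hG x)).1 (abs_le.mp (hG x)).2
  have hVb : ∀ m, |V m| ≤ (p * p + q * q) * (G : ℤ) ^ 2 := fun m => by
    have h1 := smear_le p q (fun x => g x ^ 2) m _ fun x _ _ => hsq x
    have h2 := smear_le p q (fun x => g x ^ 2) (m + 1) _ fun x _ _ => hsq x
    have h3 := le_smear p q (fun x => g x ^ 2) m 0 fun x _ _ => sq_nonneg _
    have h4 := le_smear p q (fun x => g x ^ 2) (m + 1) 0 fun x _ _ => sq_nonneg _
    rw [abs_le, hV]
    constructor <;> linarith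
  have hVs : ∀ m, V (m + 1) - V m = lap p q (fun x => g x ^ 2) (m + 1) := fun m => by
    rw [← smear_second_difference]
    simp only [hV, add_sub_cancel_right]
    ring
  have hnn : ∀ m, a ≤ m → m ≤ b → 0 ≤ lap p q (fun x => g x ^ 2) m := fun m h1 h2 => by
    rw [lap_sq (hg m h1 h2)]; positivity
  have hmono : ∀ (d : ℕ) (m : ℤ), a ≤ m → m + d ≤ b → V m ≤ V (m + d) ∧
      (V (m + d) ≤ V m → ∀ x, m < x → x ≤ m + d → lap p q (fun x => g x ^ 2) x = 0) := by
    intro d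
    induction d with
    | zero => intro m _ _; exact ⟨by simp, fun _ x _ _ => by push_cast at *; omega⟩
    | succ d ih =>
      intro m h1 h2
      push_cast at h2 ⊢
      obtain ⟨i1, i2⟩ := ih m h1 (by omega)
      have h3 := hVs (m + d)
      have h4 := hnn (m + d + 1) (by omega) (by omega)
      rw [← add_assoc]
      refine ⟨by linarith, fun hle x h5 h6 => ?_⟩
      rcases eq_or_lt_of_le h6 with h7 | h7
      · rw [h7]; linarith
      · exact i2 (by linarith) x h5 (by omega)
  -- The integer `V` has net increase at most `r - 1`, so it cannot grow on each of `r` blocks. On a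
  -- block without growth the energy of `g` vanishes.
  have hblock : ∃ i : ℕ, i < r ∧ V (a + i * l + l) ≤ V (a + i * l) := by
    by_contra! hcon
    have : ∀ i : ℕ, i ≤ r → V a + i ≤ V (a + i * l) := by
      intro i
      induction i with
      | zero => simp
      | succ i ih =>
        intro hi
        have h1 := ih (by omega)
        have h2 := hcon i (by omega)
        push_cast
        rw [show a + ((i : ℤ) + 1) * l = a + i * l + l by ring]
        linarith
    have h1 := this r le_rfl
    have h2 := (abs_le.mp (hVb a)).1
    have h3 := (abs_le.mp (hVb (a + r * l))).2
    rw [hr] at h1 h3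
    push_cast at h1 h3
    linarith
  obtain ⟨i, hi, hVi⟩ := hblock
  set x : ℤ := a + i * l with hx
  have hax : a ≤ x := le_add_of_nonneg_right (by positivity)
  have hxb : x + l + l ≤ b := by
    have h1 : ((i : ℤ) + 1) * l ≤ r * l := by gcongr; exact_mod_cast hi
    push_cast at hab
    linarith
  have hzero := (hmono l x hax (by omega)).2 hVi
  have hloc : ∀ y, x < y → y ≤ x + l →
      g (y + p) = g y ∧ g (y - p) = g y ∧ g (y + q) = g y ∧ g (y - q) = g y :=
    fun y h1 h2 => eq_of_lap_sq_eq_zero (hg y (by omega) (by omega)) (hzero y h1 h2)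
  have hlz : (l : ℤ) = s * p + 2 * (p + q) + 1 := by rw [hl]; push_cast; ring
  have hstep : ∀ y, x < y → y + s * p ≤ x + l → g (y + 1) = g y := fun y h1 h2 =>
    step_of_propagates hst (fun z => g z = g y) y
      (fun z h3 h4 h5 => by rw [(hloc z (by omega) (by linarith)).1, h5])
      (fun z h3 h4 h5 => by rw [(hloc z (by omega) (by linarith)).2.2.2, h5]) rfl
  have hwin : ∀ d : ℕ, d ≤ 2 * (p + q) → g (x + 1 + d) = g (x + 1) := by
    intro d
    induction d with
    | zero => simp
    | succ d ih =>
      intro hd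
      have hd' : (d : ℤ) + 1 ≤ 2 * (p + q) := by exact_mod_cast hd
      rw [← ih (by omega)]
      push_cast
      rw [← add_assoc]
      exact hstep _ (by omega) (by linarith)
  have hspn : (0 : ℤ) ≤ s * p := by positivity
  have hall := eq_const_of_lap_eq_zero hp hq hg (x := x + 1) (c := g (x + 1)) (by omega)
    (by linarith) (fun m h1 h2 => by
      have := hwin (m - (x + 1)).toNat (by omega)
      rwa [Int.toNat_of_nonneg (by omega), add_sub_cancel] at this)
  intro m h1 h2
  rw [hall m h1 h2, hall a le_rfl (by omega)]

end WaveCylinder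

/-! ### Flux and the shape of superharmonic profiles -/

namespace WaveCylinder

lemma lap_forwardDiff (p q : ℕ) (h : ℤ → ℤ) (m : ℤ) :
    lap p q (fun x => h (x + 1) - h x) m = lap p q h (m + 1) - lap p q h m := by
  unfold lap
  simp only [show m + (p : ℤ) + 1 = m + 1 + p by ring, show m - (p : ℤ) + 1 = m + 1 - p by ring,
    show m + (q : ℤ) + 1 = m + 1 + q by ring, show m - (q : ℤ) + 1 = m + 1 - q by ring]
  ring

lemma abs_sub_le_of_abs_forwardDiff_le {h : ℤ → ℤ} {G : ℤ} (hG : ∀ m, |h (m + 1) - h m| ≤ G)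
    (m : ℤ) (d : ℕ) : |h (m + d) - h m| ≤ G * d := by
  induction d with
  | zero => simp
  | succ d ih =>
    have h1 := abs_le.mp (hG (m + d))
    have h2 := abs_le.mp ih
    push_cast
    rw [← add_assoc, abs_le]
    constructor <;> linarith [h1.1, h1.2, h2.1, h2.2]

lemma eq_add_mul_of_forwardDiff_eq {h : ℤ → ℤ} {a b c : ℤ}
    (hc : ∀ m, a ≤ m → m < b → h (m + 1) - h m = c) {m : ℤ} (ham : a ≤ m) (hmb : m ≤ b) :
    h m = h a + c * (m - a) := by
  induction m, ham using Int.leInduction with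
  | base => simp
  | succ m ham ih =>
    have h1 := ih (by omega)
    have h2 := hc m ham (by omega)
    linarith

/-- The flux of `h` across the cut between `m` and `m + 1`. -/
def flux (p q : ℕ) (h : ℤ → ℤ) (m : ℤ) : ℤ := smear p q (fun x => h (x + 1) - h x) m

lemma flux_succ (p q : ℕ) (h : ℤ → ℤ) (m : ℤ) :
    flux p q h (m + 1) = flux p q h m + lap p q h (m + 1) := by
  rw [← smear_second_difference, flux, flux, ← smear_succ_sub, ← smear_succ_sub,
    add_sub_cancel_right]
  ring

lemma flux_antitone {p q : ℕ} {h : ℤ → ℤ} {A : ℤ} (hs : ∀ m, A < m → lap p q h m ≤ 0) {m m' : ℤ}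
    (hA : A ≤ m) (hm : m ≤ m') : flux p q h m' ≤ flux p q h m := by
  induction m', hm using Int.leInduction with
  | base => exact le_rfl
  | succ x hx ih =>
    have := hs (x + 1) (by omega)
    rw [flux_succ]
    linarith

lemma lap_eq_zero_of_flux_eq {p q : ℕ} {h : ℤ → ℤ} {m c : ℤ} (h₁ : flux p q h m = c)
    (h₀ : flux p q h (m - 1) = c) : lap p q h m = 0 := by
  have := flux_succ p q h (m - 1)
  rw [sub_add_cancel] at this
  linarith

/-- Where the flux is constant on a long interval, the function is affine. -/
lemma exists_forwardDiff_eq {p q : ℕ} {h : ℤ → ℤ} {R : ℕ}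
    (hR : ∀ a b : ℤ, (∀ m, a ≤ m → m ≤ b → lap p q (fun x => h (x + 1) - h x) m = 0) →
      a + R ≤ b → ∀ m, a ≤ m → m ≤ b → h (m + 1) - h m = h (a + 1) - h a)
    {a b c : ℤ} (hc : ∀ m, a ≤ m → m ≤ b → flux p q h m = c)
    (hab : a + (R + 2 * (p + q) + 2) ≤ b) :
    ∃ d, (p * p + q * q) * d = c ∧ ∀ m, a < m → m < b → h (m + 1) - h m = d := by
  have hl : ∀ m, a < m → m ≤ b → lap p q h m = 0 := fun m h1 h2 =>
    lap_eq_zero_of_flux_eq (hc m (by omega) h2) (hc (m - 1) (by omega) (by omega))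
  have hd := hR (a + 1) (b - 1) (fun m h1 h2 => by
    rw [lap_forwardDiff, hl m (by omega) (by omega), hl (m + 1) (by omega) (by omega), sub_zero])
    (by omega)
  refine ⟨_, ?_, fun m h1 h2 => hd m (by omega) (by omega)⟩
  rw [← hc (a + 1 + (p + q)) (by omega) (by omega)]
  exact (smear_eq p q _ _ _ fun x h1 h2 => hd x (by omega) (by omega)).symm

/-- The profile of a nonnegative bounded function of bounded gradient, superharmonic on a half-line
and of growth at most one: outside a bounded boundary region and a bounded transition region it is
the minimum of a function of slope one and a constant. -/
lemma exists_profile {p q : ℕ} (hp : 0 < p) (hq : 0 < q) (hpq : Nat.Coprime p q) (A K G : ℕ) :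
    ∃ c₁ C : ℕ, ∀ (h : ℤ → ℤ) (n : ℕ), (∀ m, 0 ≤ h m) → (∀ m, h m ≤ n) →
      (∀ m, -(K : ℤ) ≤ m → h m ≤ m + K) → (∀ m, |h (m + 1) - h m| ≤ G) →
      (∀ m, (A : ℤ) < m → lap p q h m ≤ 0) → (∃ M, ∀ m, M ≤ m → h m = n) → C ≤ n →
      ∀ m : ℤ, C ≤ m → (h m ≠ min (m + (h c₁ - c₁)) n ∨ lap p q h m ≠ 0) →
        |m + (h c₁ - c₁) - n| ≤ C := by
  obtain ⟨R, hR⟩ := exists_length_eq_const hp hq hpq G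
  set P : ℕ := p * p + q * q with hP
  have hP0 : 0 < P := by positivity
  have hPz : (P : ℤ) = p * p + q * q := by rw [hP]; push_cast; ring
  set R' : ℕ := R + 2 * (p + q) + 2 with hR'
  -- Far enough that `smear`, growing with slope at least `P + 1` from `A` to `c₀ + 1`, would exceed
  -- the bound coming from `h m ≤ m + K`.
  set c₀ : ℕ := (P + 1) * A + P * (p + q + K) with hc₀
  set Z : ℕ := P * R' with hZ
  set Y : ℕ := G * (Z + 2) with hY
  refine ⟨c₀ + 1, c₀ + R' + K + Z + 10 + Y, fun h n h0 hn hK hG hs hM hCn m hCm hdef => ?_⟩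
  push_cast at hCm hdef ⊢
  replace hR := fun a b => hR (fun x => h (x + 1) - h x) a b hG
  set F := flux p q h with hF
  have hanti : ∀ {m m' : ℤ}, (A : ℤ) ≤ m → m ≤ m' → F m' ≤ F m := fun h1 h2 =>
    flux_antitone hs h1 h2
  have hAc : A ≤ c₀ := by rw [hc₀]; nlinarith
  obtain ⟨M, hM⟩ := hM
  have hFar : ∀ m, M + (p + q) ≤ m → F m = 0 := fun m hm => by
    have := smear_eq p q (fun x => h (x + 1) - h x) m 0 fun x h1 h2 => by
      rw [hM x (by omega), hM (x + 1) (by omega), sub_self]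
    rwa [mul_zero] at this
  have hF0 : ∀ m, (A : ℤ) ≤ m → 0 ≤ F m := fun m hm => by
    rw [← hFar (max m (M + (p + q))) (le_max_right _ _)]
    exact hanti hm (le_max_left _ _)
  have hFc₀ : F c₀ ≤ P := by
    by_contra! hcon
    have hgrow : ∀ d : ℕ, A + d ≤ c₀ + 1 →
        smear p q h A + (P + 1) * d ≤ smear p q h (A + d) := by
      intro d
      induction d with
      | zero => simp
      | succ d ih =>
        intro hd
        have h1 := ih (by omega)
        have h2 : F c₀ ≤ F (A + d) := hanti (by omega) (by omega)
        rw [hF, flux, flux, ← smear_succ_sub, ← smear_succ_sub] at h2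
        rw [hF, flux, ← smear_succ_sub] at hcon
        push_cast
        rw [← add_assoc]
        linarith
    have h1 := hgrow (c₀ + 1 - A) (by omega)
    rw [Nat.cast_sub (by omega)] at h1
    push_cast at h1
    rw [show (A : ℤ) + (c₀ + 1 - A) = c₀ + 1 by ring] at h1
    have h2 := le_smear p q h A 0 fun x _ _ => h0 x
    have h4 : (p + q : ℕ) ≤ c₀ := by rw [hc₀]; nlinarith
    have h3 := smear_le p q h (c₀ + 1) (c₀ + 1 + (p + q) + K) fun x h5 h6 =>
      (hK x (by omega)).trans (by omega)
    rw [← hPz] at h3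
    have h5 : (c₀ : ℤ) = (P + 1) * A + P * (p + q + K) := by rw [hc₀]; push_cast; ring
    nlinarith
  -- A value persisting over `R'` steps would be a multiple of `P` strictly between `0` and `P`.
  have hlevel : ∀ m, (A : ℤ) ≤ m → 0 < F m → F m < P → F (m + R') ≤ F m - 1 := by
    intro m hm hpos hlt
    by_contra! hcon
    obtain ⟨d, hd, -⟩ := exists_forwardDiff_eq hR (a := m) (b := m + R') (c := F m)
      (fun x h1 h2 => le_antisymm (hanti hm h1)
        ((Int.sub_one_lt_iff.mp hcon).trans (hanti (by omega) h2))) (by rw [hR']; push_cast; omega)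
    rw [← hPz] at hd
    rw [← hd] at hpos hlt
    have hPp : (0 : ℤ) < P := by exact_mod_cast hP0
    have h1 : 0 < d := pos_of_mul_pos_right hpos hPp.le
    nlinarith
  -- The transition starts at `β`, where the flux first falls below `P`, and is over by `β + Z`.
  obtain ⟨β, ⟨hβc, hβP⟩, hβ⟩ := Int.exists_least_of_bdd (P := fun m => (c₀ : ℤ) ≤ m ∧ F m < P)
    ⟨c₀, fun z hz => hz.1⟩ ⟨max c₀ (M + (p + q)), le_max_left _ _, by
      rw [hFar _ (le_max_right _ _)]; exact_mod_cast hP0⟩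
  have hFP : ∀ m, (c₀ : ℤ) ≤ m → m < β → F m = P := fun m h1 h2 => by
    refine le_antisymm ((hanti (by omega) h1).trans hFc₀) ?_
    by_contra! hcon
    have := hβ m ⟨h1, hcon⟩
    omega
  have hdrop : ∀ i : ℕ, F (β + i * R') ≤ max (P - 1 - i : ℤ) 0 := by
    intro i
    induction i with
    | zero => simp only [Nat.cast_zero, zero_mul, add_zero, sub_zero]; omega
    | succ i ih =>
      have hnn : (0 : ℤ) ≤ i * R' := by positivity
      push_cast
      rw [show β + ((i : ℤ) + 1) * R' = β + i * R' + R' by ring]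
      have h1 := hanti (m := β + i * R') (m' := β + i * R' + R') (by linarith) (by omega)
      rcases le_or_gt (F (β + i * R')) 0 with h2 | h2
      · exact (h1.trans h2).trans (le_max_right _ _)
      · have := hlevel _ (by linarith) h2 (by omega)
        omega
  have hZz : (P : ℤ) * R' = Z := by rw [hZ]; push_cast; ring
  have hγ : ∀ m, β + Z ≤ m → F m = 0 := fun m hm => by
    refine le_antisymm ((hanti (by omega) hm).trans ?_) (hF0 m (by omega))
    have := hdrop P
    rw [hZz] at this
    omega
  have hhn : ∀ m, β + Z < m → h m = n := fun m hm => by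
    obtain ⟨d, hd, hd'⟩ := exists_forwardDiff_eq hR (a := β + Z) (b := max m M + R' + 1) (c := 0)
      (fun x h1 _ => hγ x h1) (by rw [hR']; push_cast; omega)
    rw [← hPz] at hd
    have hd0 : d = 0 := by
      rcases mul_eq_zero.mp hd with h1 | h1
      · exact absurd h1 (by exact_mod_cast hP0.ne')
      · exact h1
    have := eq_add_mul_of_forwardDiff_eq (h := h) (a := m) (b := max m M) (c := d)
      (fun x h1 h2 => hd' x (by omega) (by omega)) (le_max_left m M) le_rfl
    rw [hM _ (le_max_right _ _), hd0] at this
    linarith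
  -- Here `h` has already reached `n`, so the growth bound and `C ≤ n` push `β` far beyond `c₀`: the
  -- stretch of flux `P` is long enough to have a well-defined slope.
  have hbig := hK (β + Z + 1) (by omega)
  rw [hhn _ (by omega)] at hbig
  obtain ⟨d, hd, hd'⟩ := exists_forwardDiff_eq hR (a := c₀) (b := β - 1) (c := P)
      (fun x h1 h2 => hFP x h1 (by omega)) (by rw [hR'] at hCn; omega)
  have hd1 : d = 1 := by
    rw [← hPz] at hd
    have hPp : (P : ℤ) ≠ 0 := by exact_mod_cast hP0.ne'
    exact mul_left_cancel₀ hPp (by linarith)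
  subst hd1
  set k : ℤ := h (c₀ + 1) - (c₀ + 1) with hk
  have hlin : ∀ m, (c₀ : ℤ) < m → m ≤ β - 1 → h m = m + k := fun m h1 h2 => by
    have := eq_add_mul_of_forwardDiff_eq (h := h) (a := c₀ + 1) (b := β - 1) (c := 1)
      (fun x h1 h2 => hd' x (by omega) (by omega)) (m := m) (by omega) h2
    linarith
  -- The gradient bound across the transition ties `β` to `n - k`.
  have hjump : |(n : ℤ) - (β - 1 + k)| ≤ Y := by
    have := abs_sub_le_of_abs_forwardDiff_le hG (β - 1) (Z + 2)
    rw [hlin (β - 1) (by omega) le_rfl, hhn _ (by push_cast; omega)] at this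
    rw [hY]
    exact_mod_cast this
  rw [abs_le] at hjump ⊢
  rcases lt_or_ge m β with h1 | h1
  · exfalso
    have h2 := hlin m (by omega) (by omega)
    have h3 := hn m
    rcases hdef with h4 | h4
    · exact h4 (by omega)
    · exact h4 (lap_eq_zero_of_flux_eq (hFP m (by omega) h1) (hFP (m - 1) (by omega) (by omega)))
  rcases le_or_gt m (β + Z) with h2 | h2
  · constructor <;> omega
  · rcases hdef with h4 | h4
    · rw [hhn m h2] at h4
      constructor <;> omega
    · exact absurd (lap_eq_zero_of_flux_eq (hγ m (by omega)) (hγ (m - 1) (by omega))) h4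

end WaveCylinder

/-! ### Relaxations, waves and the least action principle -/

namespace WaveCylinder

variable {p q : ℕ}

/-- The Laplacian of the cylinder. -/
def cylLap (f : Cyl p q → ℤ) (w : Cyl p q) : ℤ :=
  f (w + stepX p q) + f (w - stepX p q) + f (w + stepY p q) + f (w - stepY p q) - 4 * f w

lemma cylLap_add (f g : Cyl p q → ℤ) (w : Cyl p q) :
    cylLap (fun x => f x + g x) w = cylLap f w + cylLap g w := by
  unfold cylLap; ring

lemma cylLap_sub (f g : Cyl p q → ℤ) (w : Cyl p q) :
    cylLap (fun x => f x - g x) w = cylLap f w - cylLap g w := by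
  unfold cylLap; ring

lemma topple_apply (v : Cyl p q) (φ : State p q) (w : Cyl p q) :
    topple v φ w = φ w + cylLap (grain v) w := by
  have h1 : ∀ a : Cyl p q, grain (v + a) w = grain v (w - a) := fun a => by
    simp only [grain, sub_eq_iff_eq_add]
  have h2 : ∀ a : Cyl p q, grain (v - a) w = grain v (w + a) := fun a => by
    simp only [grain, eq_sub_iff_add_eq]
  simp only [topple, cylLap, Pi.add_apply, Pi.sub_apply, Pi.smul_apply, h1, h2]
  rw [nsmul_eq_mul]
  push_cast
  ring

open Classical in
/-- The number of topplings at `w` among the first `i` steps. -/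
noncomputable def topplingCount (x : ℕ → Option (Cyl p q)) (i : ℕ) (w : Cyl p q) : ℕ :=
  Nat.count (fun j => x j = some w) i

lemma run_apply (φ : State p q) (x : ℕ → Option (Cyl p q)) (i : ℕ) (w : Cyl p q) :
    run φ x i w = φ w + cylLap (fun y => (topplingCount x i y : ℤ)) w := by
  induction i generalizing w with
  | zero => simp [run, topplingCount, cylLap]
  | succ i ih =>
    have hc : ∀ y, (topplingCount x (i + 1) y : ℤ) =
        topplingCount x i y + if x i = some y then 1 else 0 := fun y => by
      simp only [topplingCount, Nat.count_succ]; push_cast; rfl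
    simp only [hc]
    rw [cylLap_add, ← add_assoc, ← ih]
    cases hx : x i with
    | none => simp [run, hx, cylLap]
    | some v =>
      simp only [run, hx, topple_apply, Option.some.injEq, add_right_inj]
      congr 1
      funext y
      simp only [grain, eq_comm]

/-- The least action principle. -/
lemma topplingCount_le {A : Set (Cyl p q)} {φ : State p q} {x : ℕ → Option (Cyl p q)}
    (hx : ∀ i w, x i = some w → w ∈ A ∧ 4 ≤ run φ x i w) {u : Cyl p q → ℕ}
    (hu : ∀ w ∈ A, φ w + cylLap (fun y => (u y : ℤ)) w < 4) (i : ℕ) (w : Cyl p q) :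
    topplingCount x i w ≤ u w := by
  induction i generalizing w with
  | zero => simp [topplingCount]
  | succ i ih =>
    have hc : topplingCount x (i + 1) w = topplingCount x i w + if x i = some w then 1 else 0 := by
      simp only [topplingCount, Nat.count_succ]
    rw [hc]
    split_ifs with hw
    · obtain ⟨hA, h4⟩ := hx i w hw
      -- If `w` has used up its quota `u w` while its neighbours are within theirs, it holds no more
      -- sand than `u` would leave there, so toppling it is illegal.
      rcases (ih w).eq_or_lt with heq | hlt
      · exfalso
        have h1 := hu w hA
        rw [run_apply] at h4
        simp only [cylLap] at h1 h4
        have a1 := ih (w + stepX p q)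
        have a2 := ih (w - stepX p q)
        have a3 := ih (w + stepY p q)
        have a4 := ih (w - stepY p q)
        omega
      · exact hlt
    · exact ih w

lemma eventually_topplingCount_eq {x : ℕ → Option (Cyl p q)} {w : Cyl p q}
    (hf : {i | x i = some w}.Finite) :
    ∀ᶠ i in Filter.atTop, topplingCount x i w = {i | x i = some w}.ncard := by
  obtain ⟨B, hB⟩ := hf.bddAbove
  filter_upwards [Filter.eventually_gt_atTop B] with i hi
  rw [topplingCount, Nat.count_eq_card_filter_range, ← Set.ncard_coe_finset]
  congr 1
  ext j
  simp only [Finset.coe_filter, Finset.mem_range, Set.mem_ofPred_eq, and_iff_right_iff_imp]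
  intro hj
  exact (hB hj).trans_lt hi

lemma eventually_run_eq {φ : State p q} {x : ℕ → Option (Cyl p q)} {u : Cyl p q → ℕ}
    (hu : ∀ w, {i | x i = some w}.Finite ∧ u w = {i | x i = some w}.ncard) (w : Cyl p q) :
    ∀ᶠ i in Filter.atTop, run φ x i w = φ w + cylLap (fun y => (u y : ℤ)) w := by
  have h : ∀ y, ∀ᶠ i in Filter.atTop, topplingCount x i y = u y := fun y => by
    rw [(hu y).2]
    exact eventually_topplingCount_eq (hu y).1
  filter_upwards [h w, h (w + stepX p q), h (w - stepX p q), h (w + stepY p q),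
    h (w - stepY p q)] with i h0 h1 h2 h3 h4
  rw [run_apply, cylLap, cylLap, h0, h1, h2, h3, h4]

lemma Relaxes.apply_eq {A : Set (Cyl p q)} {φ ψ : State p q} {u : Cyl p q → ℕ}
    (h : Relaxes A φ u ψ) (w : Cyl p q) : ψ w = φ w + cylLap (fun y => (u y : ℤ)) w := by
  obtain ⟨x, -, hu, hψ, -⟩ := h
  obtain ⟨i, h1, h2⟩ := ((hψ w).and (eventually_run_eq hu w)).exists
  rw [← h1, h2]

lemma Relaxes.eq_zero {A : Set (Cyl p q)} {φ ψ : State p q} {u : Cyl p q → ℕ}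
    (h : Relaxes A φ u ψ) {w : Cyl p q} (hw : w ∉ A) : u w = 0 := by
  obtain ⟨x, hx, hu, -, -⟩ := h
  rw [(hu w).2, Set.ncard_eq_zero (hu w).1]
  exact Set.eq_empty_of_forall_notMem fun i hi => hw (hx i w hi).1

lemma Relaxes.le {A : Set (Cyl p q)} {φ ψ : State p q} {u u' : Cyl p q → ℕ}
    (h : Relaxes A φ u ψ) (hu' : ∀ w ∈ A, φ w + cylLap (fun y => (u' y : ℤ)) w < 4)
    (w : Cyl p q) : u w ≤ u' w := by
  obtain ⟨x, hx, hu, -, -⟩ := h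
  obtain ⟨i, hi⟩ := (eventually_topplingCount_eq (hu w).1).exists
  rw [(hu w).2, ← hi]
  exact topplingCount_le hx hu' i w

/-- A state that some toppling function stabilizes has a stabilizing relaxation. -/
lemma exists_relaxes {A : Set (Cyl p q)} {φ : State p q} {u' : Cyl p q → ℕ}
    (hu' : ∀ w ∈ A, φ w + cylLap (fun y => (u' y : ℤ)) w < 4) : ∃ u ψ, Relaxes A φ u ψ := by
  classical
  have : Countable (Cyl p q) := QuotientAddGroup.mk_surjective.countable
  obtain ⟨e, he⟩ := exists_surjective_nat (Cyl p q)
  -- A fair schedule: unpairing visits every site infinitely often.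
  let site' : ℕ → Cyl p q := fun i => e (Nat.unpair i).1
  let st : ℕ → State p q := fun i => Nat.rec (motive := fun _ => State p q) φ
    (fun j s => if site' j ∈ A ∧ 4 ≤ s (site' j) then topple (site' j) s else s) i
  let x : ℕ → Option (Cyl p q) := fun i =>
    if site' i ∈ A ∧ 4 ≤ st i (site' i) then some (site' i) else none
  have hrun : ∀ i, run φ x i = st i := by
    intro i
    induction i with
    | zero => rfl
    | succ i ih =>
      by_cases hc : site' i ∈ A ∧ 4 ≤ st i (site' i)
      · have hx : x i = some (site' i) := if_pos hc
        have hs : st (i + 1) = topple (site' i) (st i) := if_pos hc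
        simp only [run, hx, hs, ih]
      · have hx : x i = none := if_neg hc
        have hs : st (i + 1) = st i := if_neg hc
        simp only [run, hx, hs, ih]
  have hlegal : ∀ i w, x i = some w → w ∈ A ∧ 4 ≤ run φ x i w := by
    intro i w hw
    by_cases hc : site' i ∈ A ∧ 4 ≤ st i (site' i)
    · have hx : x i = some (site' i) := if_pos hc
      rw [hx, Option.some.injEq] at hw
      rw [hrun, ← hw]
      exact hc
    · have hx : x i = none := if_neg hc
      rw [hx] at hw
      cases hw
  have hfin : ∀ w, {i | x i = some w}.Finite := by
    intro w
    by_contra hinf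
    have h1 := topplingCount_le hlegal hu' (Nat.nth (fun i => x i = some w) (u' w + 1)) w
    rw [topplingCount, Nat.count_nth_of_infinite hinf] at h1
    omega
  have hu : ∀ w, {i | x i = some w}.Finite ∧
      (fun w => {i | x i = some w}.ncard) w = {i | x i = some w}.ncard := fun w => ⟨hfin w, rfl⟩
  refine ⟨_, _, x, hlegal, hu, eventually_run_eq hu, fun w hw => ?_⟩
  by_contra! hcon
  obtain ⟨I, hI⟩ := Filter.eventually_atTop.mp (eventually_run_eq (φ := φ) hu w)
  obtain ⟨B, hB⟩ := (hfin w).bddAbove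
  obtain ⟨a, ha⟩ := he w
  set i := Nat.pair a (max I (B + 1)) with hi
  have hle : max I (B + 1) ≤ i := Nat.right_le_pair _ _
  have hs : site' i = w := by simp only [site', hi, Nat.unpair_pair, ha]
  have hxi : x i = some w := by
    rw [← hs]
    refine if_pos ⟨hs ▸ hw, ?_⟩
    rw [← hrun, hs, hI i ((le_max_left _ _).trans hle)]
    exact hcon
  have := hB (show i ∈ {i | x i = some w} from hxi)
  have := (le_max_right I (B + 1)).trans hle
  omega

lemma IsWave.apply_eq {D : Set (Cyl p q)} {v : Cyl p q} {φ φ' : State p q} {u : Cyl p q → ℕ}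
    (h : IsWave D v φ u φ') (w : Cyl p q) : φ' w = φ w + cylLap (fun y => (u y : ℤ)) w := by
  obtain ⟨-, -, u₀, ψ, hr, rfl, rfl⟩ := h
  have hg : (fun y => ((u₀ y + if y = v then 1 else 0 : ℕ) : ℤ)) =
      fun y => (u₀ y : ℤ) + grain v y := by
    funext y; simp [grain]
  rw [hg, cylLap_add, Pi.sub_apply, hr.apply_eq, topple_apply, Pi.add_apply]
  ring

lemma IsWave.apply_self {D : Set (Cyl p q)} {v : Cyl p q} {φ φ' : State p q} {u : Cyl p q → ℕ}
    (h : IsWave D v φ u φ') : u v = 1 := by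
  obtain ⟨-, -, u₀, ψ, hr, rfl, rfl⟩ := h
  simp [hr.eq_zero (w := v) (by simp)]

lemma IsWave.lt_four {D : Set (Cyl p q)} {v : Cyl p q} {φ φ' : State p q} {u : Cyl p q → ℕ}
    (h : IsWave D v φ u φ') {w : Cyl p q} (hw : w ∈ D) (hwv : w ≠ v) : φ' w < 4 := by
  obtain ⟨-, -, u₀, ψ, ⟨x, -, -, -, hs⟩, rfl, rfl⟩ := h
  simpa [grain, hwv] using hs w ⟨hw, hwv⟩

/-- Removing the forced toppling at `v` turns a competitor for the whole wave into one for its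
relaxation, so that the least action principle carries over to waves. -/
lemma topple_grain_add_cylLap_lt {D : Set (Cyl p q)} {v : Cyl p q} {φ : State p q}
    {u : Cyl p q → ℕ} (hv : 1 ≤ u v)
    (hu : ∀ w ∈ D, w ≠ v → φ w + cylLap (fun y => (u y : ℤ)) w < 4) :
    ∃ u₀ : Cyl p q → ℕ, (∀ w, (u w : ℤ) = u₀ w + grain v w) ∧ ∀ w ∈ D \ {v},
      topple v (φ + grain v) w + cylLap (fun y => (u₀ y : ℤ)) w < 4 := by
  classical
  have hg : ∀ y, ((u y - if y = v then 1 else 0 : ℕ) : ℤ) = (u y : ℤ) - grain v y := fun y => by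
    by_cases hy : y = v
    · subst hy; simp [grain, hv]
    · simp [grain, hy]
  refine ⟨fun y => u y - if y = v then 1 else 0, fun w => by rw [hg]; ring, fun w hw => ?_⟩
  simp only [hg]
  rw [cylLap_sub, topple_apply, Pi.add_apply]
  have h0 : grain v w = 0 := by simp [grain, show w ≠ v from hw.2]
  have := hu w hw.1 hw.2
  rw [h0]
  linarith

lemma IsWave.le {D : Set (Cyl p q)} {v : Cyl p q} {φ φ' : State p q} {u u' : Cyl p q → ℕ}
    (h : IsWave D v φ u φ') (hv : 1 ≤ u' v)
    (hu' : ∀ w ∈ D, w ≠ v → φ w + cylLap (fun y => (u' y : ℤ)) w < 4) (w : Cyl p q) :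
    u w ≤ u' w := by
  obtain ⟨-, -, u₀, ψ, hr, rfl, rfl⟩ := h
  obtain ⟨u₁, h1, h2⟩ := topple_grain_add_cylLap_lt hv hu'
  have h3 := hr.le h2 w
  have h4 := h1 w
  zify at h3 ⊢
  rw [h4]
  simp only [grain]
  linarith

lemma exists_isWave {D : Set (Cyl p q)} {v : Cyl p q} {φ : State p q} {u' : Cyl p q → ℕ}
    (hs : StableOn D φ) (ht : InTerritory D φ v) (hv : 1 ≤ u' v)
    (hu' : ∀ w ∈ D, w ≠ v → φ w + cylLap (fun y => (u' y : ℤ)) w < 4) :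
    ∃ u φ', IsWave D v φ u φ' := by
  obtain ⟨u₁, -, h2⟩ := topple_grain_add_cylLap_lt hv hu'
  obtain ⟨u₀, ψ, hr⟩ := exists_relaxes h2
  exact ⟨_, _, hs, ht, u₀, ψ, hr, rfl, rfl⟩

/-- Minimality passes from single waves to their sum: a competitor `f` for `n + 1` waves dominates
the first `n` by induction, and the remainder `f - h₀` is a competitor for the last wave, since
together they leave `3 + cylLap f ≤ 3` grains at internal sites off `v`. -/
lemma Waves.spec {D : Set (Cyl p q)} {v : Cyl p q} {n : ℕ} {h : Cyl p q → ℕ} {φ : State p q}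
    (hw : Waves D v n h φ) :
    (∀ w, φ w = maximalState D w + cylLap (fun y => (h y : ℤ)) w) ∧ h v = n ∧
      (∀ w ∈ D, w ≠ v → cylLap (fun y => (h y : ℤ)) w ≤ 0) ∧
      ∀ f : Cyl p q → ℕ, n ≤ f v → (∀ w ∈ D, w ≠ v → cylLap (fun y => (f y : ℤ)) w ≤ 0) →
        ∀ w, h w ≤ f w := by
  induction n generalizing h φ with
  | zero =>
    obtain ⟨rfl, rfl⟩ := hw
    simp [cylLap]
  | succ n ih =>
    obtain ⟨h₀, φ₀, u, hw₀, hu, rfl⟩ := hw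
    obtain ⟨i1, i2, i3, i4⟩ := ih hw₀
    have hD : ∀ w ∈ D, maximalState D w = 3 := fun w hw => by simp [maximalState, hw]
    have e1 : ∀ w, φ w = maximalState D w + cylLap (fun y => ((h₀ + u) y : ℤ)) w := fun w => by
      rw [hu.apply_eq, i1]
      simp only [Pi.add_apply, Nat.cast_add]
      rw [cylLap_add]
      ring
    refine ⟨e1, by rw [Pi.add_apply, i2, hu.apply_self], fun w hw hwv => ?_, fun f hf hfD w => ?_⟩
    · have h1 := e1 w
      have h2 := hu.lt_four hw hwv
      rw [hD w hw] at h1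
      omega
    · have hle := i4 f (by omega) hfD
      have hc : ∀ y, ((f y - h₀ y : ℕ) : ℤ) = (f y : ℤ) - h₀ y := fun y => Nat.cast_sub (hle y)
      have := hu.le (u' := fun y => f y - h₀ y) (by show 1 ≤ f v - h₀ v; omega)
        (fun w hw hwv => by
          simp only [hc]
          rw [cylLap_sub, i1, hD w hw]
          linarith [hfD w hw hwv]) w
      have h1 := hle w
      simp only [Pi.add_apply]
      omega

end WaveCylinder

/-! ### Comparison estimates for wave profiles -/

namespace WaveCylinder

variable {p q : ℕ}

/-- The least nonnegative function that is superharmonic on `D \ {v}` and has value at least `n`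
at `v`, in the height coordinate. -/
structure IsWaveProfile (p q : ℕ) (D : Set ℤ) (v : ℤ) (n : ℕ) (h : ℤ → ℤ) : Prop where
  nonneg : ∀ m, 0 ≤ h m
  apply_self : h v = n
  lap_nonpos_of_ne : ∀ m ∈ D, m ≠ v → lap p q h m ≤ 0
  le_of_superharmonic : ∀ s : ℤ → ℤ, (∀ m, 0 ≤ s m) → n ≤ s v →
    (∀ m ∈ D, m ≠ v → lap p q s m ≤ 0) → ∀ m, h m ≤ s m

namespace IsWaveProfile

variable {D : Set ℤ} {v : ℤ} {n : ℕ} {h : ℤ → ℤ}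

lemma le_natCast (H : IsWaveProfile p q D v n h) (m : ℤ) : h m ≤ n :=
  H.le_of_superharmonic (fun _ => n) (fun _ => by positivity) le_rfl
    (fun _ _ _ => by unfold lap; linarith) m

/-- The source is no exception because the maximum `n` is attained there. This makes profiles with
different sources comparable. -/
lemma lap_nonpos (H : IsWaveProfile p q D v n h) {m : ℤ} (hm : m ∈ D) : lap p q h m ≤ 0 := by
  by_cases hv : m = v
  · subst hv
    unfold lap
    rw [H.apply_self]
    linarith [H.le_natCast (m + p), H.le_natCast (m - p), H.le_natCast (m + q),
      H.le_natCast (m - q)]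
  · exact H.lap_nonpos_of_ne m hm hv

lemma le_of_le {v' : ℤ} {n' : ℕ} {h' : ℤ → ℤ} (H : IsWaveProfile p q D v n h)
    (H' : IsWaveProfile p q D v' n' h') (hv : n ≤ h' v) (m : ℤ) : h m ≤ h' m :=
  H.le_of_superharmonic h' H'.nonneg hv (fun _ hm _ => H'.lap_nonpos hm) m

/-- Where the profile of height `n` is flat, the next profile is flat, too. -/
lemma eq_succ_of_eq {h₀ : ℤ → ℤ} (hp : 0 < p) (hq : 0 < q) (hpq : Nat.Coprime p q) {M : ℤ}
    (H₀ : IsWaveProfile p q D v n h₀) (H : IsWaveProfile p q D v (n + 1) h)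
    (hMD : ∀ m, M ≤ m → m ∈ D) (hM : ∀ m, M ≤ m → h₀ m = n) (hv : M + (p + q) ≤ v) (m : ℤ)
    (hm : M + (p + q) ≤ m) : h m = n + 1 := by
  have hle : ∀ m, h₀ m ≤ h m := H₀.le_of_le H (by rw [H.apply_self]; push_cast; linarith)
  have hlap : ∀ m, M + (p + q) ≤ m → lap p q h m - lap p q h₀ m ≤ 0 := fun m hm => by
    have h1 := H.lap_nonpos (hMD m (by omega))
    have h2 : lap p q h₀ m = 0 := by
      unfold lap
      rw [hM _ (by omega), hM _ (by omega), hM _ (by omega), hM _ (by omega), hM _ (by omega)]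
      ring
    linarith
  -- Strong minimum principle: a zero of the nonnegative superharmonic `h - h₀` forces zeros at its
  -- four neighbours.
  have hprop : ∀ y, M + (p + q) ≤ y →
      (h₀ (y + p) < h (y + p) ∨ h₀ (y - p) < h (y - p) ∨ h₀ (y + q) < h (y + q) ∨
        h₀ (y - q) < h (y - q)) → h₀ y < h y := fun y hy hor => by
    have h1 := hlap y hy
    have := hle (y + p)
    have := hle (y - p)
    have := hle (y + q)
    have := hle (y - q)
    unfold lap at h1
    by_contra! hcon
    omega
  obtain ⟨s, t, hst⟩ := exists_mul_eq_mul_add_one hp hq hpq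
  have hup : ∀ y, M + (p + q) ≤ y → h₀ y < h y → h₀ (y + 1) < h (y + 1) := fun y hy =>
    step_of_propagates hst (fun z => h₀ z < h z) y
      (fun z h1 _ h3 => hprop _ (by omega) (Or.inr (Or.inl (by rwa [add_sub_cancel_right]))))
      (fun z h1 _ h3 => hprop _ (by omega) (Or.inr (Or.inr (Or.inl (by rwa [sub_add_cancel])))))
  have hdown : ∀ y, M + (p + q) ≤ y → h₀ (y + 1) < h (y + 1) → h₀ y < h y := fun y hy => by
    contrapose
    exact step_of_propagates hst (fun z => ¬ h₀ z < h z) y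
      (fun z h1 _ h3 h4 => h3 (hprop z (by omega) (Or.inl h4)))
      (fun z h1 _ h3 h4 => h3 (hprop z (by omega) (Or.inr (Or.inr (Or.inr h4)))))
  have hlt : h₀ m < h m := by
    have h0 : h₀ v < h v := by rw [H₀.apply_self, H.apply_self]; push_cast; omega
    rcases le_total v m with hvm | hvm
    · induction m, hvm using Int.leInduction with
      | base => exact h0
      | succ m hvm ih => exact hup m (by omega) (ih (by omega))
    · induction m, hvm using Int.leInductionDown with
      | base => exact h0
      | pred m hvm ih => exact hdown _ hm (by rw [sub_add_cancel]; exact ih (by omega))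
  have h1 := H.le_natCast m
  rw [hM m (by omega)] at hlt
  push_cast at h1
  omega

/-- The kink of `max (m + K) 0` lies so low that this function is affine around every point of `D`,
hence an admissible competitor. -/
lemma le_max {A : ℕ} (H : IsWaveProfile p q D v n h) (hD : ∀ m ∈ D, -(A : ℤ) ≤ m) {K : ℤ}
    (hK : A + p + q ≤ K) (hv : n ≤ v + K) (m : ℤ) : h m ≤ max (m + K) 0 := by
  refine H.le_of_superharmonic (fun m => max (m + K) 0) (fun m => le_max_right _ _)
    (hv.trans (le_max_left _ _)) (fun m hm _ => ?_) m
  have := hD m hm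
  simp only [lap]
  omega

/-- The competitor is the minimum of the raised translate and `max (m + K) 0`. Where `m - t` leaves
`D`, one has `m ≤ A + 1`, so the affine branch is the smaller one and superharmonicity survives. -/
lemma le_shift_add {A : ℕ} (H : IsWaveProfile p q D v n h) (hD : ∀ m ∈ D, -(A : ℤ) ≤ m)
    (hD' : ∀ m, (A : ℤ) < m → m ∈ D) {K t : ℤ} (hK : A + p + q ≤ K) (hv : n ≤ v + K)
    (ht : |t| ≤ 1) (hvt : h (v - t) = n) (m : ℤ) : h m ≤ h (m - t) + (A + 1 + K) := by
  refine (H.le_of_superharmonic (fun m => min (h (m - t) + (A + 1 + K)) (max (m + K) 0))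
    (fun m => ?_) ?_ (fun m hm _ => ?_) m).trans (min_le_left _ _)
  · have := H.nonneg (m - t)
    omega
  · simp only [hvt]
    omega
  · have h0 := hD m hm
    have h1 := H.nonneg (m - t)
    rw [abs_le] at ht
    by_cases hmt : m - t ∈ D
    · have h2 := H.lap_nonpos hmt
      unfold lap at h2 ⊢
      simp only [show m + (p : ℤ) - t = m - t + p by ring, show m - (p : ℤ) - t = m - t - p by ring,
        show m + (q : ℤ) - t = m - t + q by ring, show m - (q : ℤ) - t = m - t - q by ring]
      omega
    · have h2 : m - t ≤ A := by
        by_contra! hcon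
        exact hmt (hD' _ hcon)
      simp only [lap]
      omega

lemma abs_forwardDiff_le {A : ℕ} (H : IsWaveProfile p q D v n h) (hD : ∀ m ∈ D, -(A : ℤ) ≤ m)
    (hD' : ∀ m, (A : ℤ) < m → m ∈ D) {K : ℤ} (hK : A + p + q ≤ K) (hv : n ≤ v + K)
    (hv₁ : h (v - 1) = n) (hv₂ : h (v + 1) = n) (m : ℤ) :
    |h (m + 1) - h m| ≤ A + 1 + K := by
  have h1 := H.le_shift_add hD hD' hK hv (t := 1) (by simp) hv₁ (m + 1)
  have h2 := H.le_shift_add hD hD' hK hv (t := -1) (by simp) (by simpa using hv₂) m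
  rw [add_sub_cancel_right] at h1
  rw [sub_neg_eq_add] at h2
  rw [abs_le]
  constructor <;> linarith

end IsWaveProfile

/-! ### The height coordinate and existence of the waves -/

/-- The height coordinate `pj - qi` on the cylinder. -/
def height (p q : ℕ) : Cyl p q →+ ℤ :=
  QuotientAddGroup.lift _ ((p : ℤ) • AddMonoidHom.snd ℤ ℤ - (q : ℤ) • AddMonoidHom.fst ℤ ℤ) <| by
    rw [AddSubgroup.zmultiples_le, AddMonoidHom.mem_ker]
    simp [mul_comm]

lemma height_site (p q : ℕ) (x : ℤ × ℤ) : height p q (site p q x) = p * x.2 - q * x.1 := by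
  simp [height, site]

lemma height_stepX : height p q (stepX p q) = -q := by simp [stepX, height_site]

lemma height_stepY : height p q (stepY p q) = p := by simp [stepY, height_site]

lemma height_injective (hp : 0 < p) (hpq : Nat.Coprime p q) : Function.Injective (height p q) := by
  rw [injective_iff_map_eq_zero]
  intro a
  induction a using QuotientAddGroup.induction_on with
  | H x =>
    intro hx
    have h1 : (p : ℤ) * x.2 - q * x.1 = 0 := by rw [← height_site]; exact hx
    have h2 : (p : ℤ) ∣ q * x.1 := ⟨x.2, by linarith⟩
    have h3 : IsCoprime (p : ℤ) (q : ℤ) := Nat.isCoprime_iff_coprime.mpr hpq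
    obtain ⟨c, hc⟩ := h3.dvd_of_dvd_mul_left h2
    rw [QuotientAddGroup.eq_zero_iff, AddSubgroup.mem_zmultiples_iff]
    refine ⟨c, Prod.ext ?_ ?_⟩
    · simp [hc, mul_comm]
    · have hp' : (p : ℤ) ≠ 0 := by exact_mod_cast hp.ne'
      apply mul_left_cancel₀ hp'
      rw [hc] at h1
      simp only [Prod.smul_mk, smul_eq_mul]
      linarith

/-- Every height is taken in a fundamental domain. -/
lemma exists_height_site_eq (hp : 0 < p) (hpq : Nat.Coprime p q) (m : ℤ) :
    ∃ i j : ℤ, 0 ≤ i ∧ i < p ∧ p * j = m + q * i := by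
  obtain ⟨a, b, hab⟩ : IsCoprime (p : ℤ) (q : ℤ) := Nat.isCoprime_iff_coprime.mpr hpq
  have hp' : (0 : ℤ) < p := by exact_mod_cast hp
  refine ⟨(-(b * m)) % p, m * a + -q * ((-(b * m)) / p), Int.emod_nonneg _ hp'.ne',
    Int.emod_lt_of_pos _ hp', ?_⟩
  have := Int.emod_add_mul_ediv (-(b * m)) p
  linear_combination m * hab - (q : ℤ) * this

lemma height_surjective (hp : 0 < p) (hpq : Nat.Coprime p q) :
    Function.Surjective (height p q) := fun m => by
  obtain ⟨i, j, -, -, h⟩ := exists_height_site_eq hp hpq m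
  exact ⟨site p q (i, j), by rw [height_site]; linarith⟩

lemma cylLap_comp_height (s : ℤ → ℤ) (w : Cyl p q) :
    cylLap (fun y => s (height p q y)) w = lap p q s (height p q w) := by
  simp only [cylLap, lap, map_add, map_sub, height_stepX, height_stepY, sub_neg_eq_add,
    ← sub_eq_add_neg]
  ring

lemma Waves.exists_isWaveProfile (hp : 0 < p) (hpq : Nat.Coprime p q) {D : Set (Cyl p q)}
    {v : Cyl p q} {n : ℕ} {h : Cyl p q → ℕ} {φ : State p q} (hw : Waves D v n h φ) :
    ∃ H : ℤ → ℤ, (∀ w, (h w : ℤ) = H (height p q w)) ∧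
      IsWaveProfile p q (height p q '' D) (height p q v) n H ∧
      ∀ w ∈ D, φ w = 3 + lap p q H (height p q w) := by
  obtain ⟨h1, h2, h3, h4⟩ := hw.spec
  obtain ⟨g, hg⟩ := (height_surjective hp hpq).hasRightInverse
  have hg' : ∀ w, g (height p q w) = w := fun w => height_injective hp hpq (hg _)
  have hH : ∀ w, (h w : ℤ) = (fun m => (h (g m) : ℤ)) (height p q w) := fun w => by
    simp only [hg']
  have hl : ∀ w, cylLap (fun y => (h y : ℤ)) w =
      lap p q (fun m => (h (g m) : ℤ)) (height p q w) := fun w => by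
    rw [← cylLap_comp_height]
    simp only [hg']
  refine ⟨fun m => h (g m), hH, ⟨fun m => by positivity, by simp [hg', h2], ?_, ?_⟩, fun w hw => ?_⟩
  · rintro _ ⟨w, hw, rfl⟩ hwv
    rw [← hl]
    exact h3 w hw fun e => hwv (by rw [e])
  · intro s hs hsv hsD m
    have hcast : ∀ y, ((s (height p q y)).toNat : ℤ) = s (height p q y) := fun y =>
      Int.toNat_of_nonneg (hs _)
    have := h4 (fun y => (s (height p q y)).toNat) (by zify; rw [hcast]; exact hsv)
      (fun w hw hwv => by
        simp only [hcast]
        rw [cylLap_comp_height]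
        exact hsD _ ⟨w, hw, rfl⟩ fun e => hwv (height_injective hp hpq e)) (g m)
    zify at this
    rwa [hcast, hg] at this
  · rw [h1, hl]
    simp [maximalState, hw]

lemma neg_le_of_mem_height_internal {S : Set (ℤ × ℤ)} {m : ℤ}
    (hm : m ∈ height p q '' internal p q S) : -((p * q : ℕ) : ℤ) ≤ m := by
  obtain ⟨_, ⟨⟨x, ⟨h1, h2, h3⟩, rfl⟩, -⟩, rfl⟩ := hm
  rw [height_site]
  push_cast
  have : (0 : ℤ) ≤ p := by positivity
  have : (0 : ℤ) ≤ q := by positivity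
  nlinarith

lemma mem_internal_of_lt (hp : 0 < p) (hpq : Nat.Coprime p q) {S : Set (ℤ × ℤ)}
    (hS : S ⊆ Set.Icc (0, 0) ((p : ℤ), (q : ℤ))) {w : Cyl p q}
    (hw : ((p * q : ℕ) : ℤ) < height p q w) : w ∈ internal p q S := by
  have hp' : (0 : ℤ) < p := by exact_mod_cast hp
  have hq' : (0 : ℤ) ≤ q := by positivity
  push_cast at hw
  constructor
  · obtain ⟨i, j, h1, h2, h3⟩ := exists_height_site_eq hp hpq (height p q w)
    refine ⟨(i, j), ⟨h1, h2.le, ?_⟩, height_injective hp hpq (by rw [height_site]; linarith)⟩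
    by_contra! hj
    simp only at hj
    nlinarith
  · rintro ⟨x, hx, rfl⟩
    obtain ⟨⟨h1, h2⟩, h3, h4⟩ := hS hx
    rw [height_site] at hw
    simp only at h1 h2 h3 h4
    nlinarith

/-- From this height on, the profile of height `n` is flat. -/
def flatHeight (p q n : ℕ) : ℕ := p * q + 1 + n * (p + q)

lemma flatHeight_succ (p q n : ℕ) : flatHeight p q (n + 1) = flatHeight p q n + (p + q) := by
  unfold flatHeight; ring

lemma Waves.eq_of_flatHeight_le (hp : 0 < p) (hq : 0 < q) (hpq : Nat.Coprime p q)
    {S : Set (ℤ × ℤ)} (hS : S ⊆ Set.Icc (0, 0) ((p : ℤ), (q : ℤ))) {v : Cyl p q} {n : ℕ}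
    {h : Cyl p q → ℕ} {φ : State p q} (hw : Waves (internal p q S) v n h φ)
    (hv : (flatHeight p q n : ℤ) ≤ height p q v) {w : Cyl p q}
    (hn : (flatHeight p q n : ℤ) ≤ height p q w) : h w = n := by
  induction n generalizing h φ w with
  | zero =>
    obtain ⟨rfl, -⟩ := hw
    rfl
  | succ n ih =>
    obtain ⟨H, hH, hprof, -⟩ := hw.exists_isWaveProfile hp hpq
    obtain ⟨h₀, φ₀, u, hw₀, -, -⟩ := hw
    obtain ⟨H₀, hH₀, hprof₀, -⟩ := hw₀.exists_isWaveProfile hp hpq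
    rw [flatHeight_succ] at hv hn
    push_cast at hv hn
    have := hprof₀.eq_succ_of_eq hp hq hpq hprof (M := flatHeight p q n)
      (fun m hm => by
        obtain ⟨y, rfl⟩ := height_surjective hp hpq m
        refine ⟨y, mem_internal_of_lt hp hpq hS ?_, rfl⟩
        unfold flatHeight at hm
        push_cast at hm ⊢
        have : (0 : ℤ) ≤ n * (p + q) := by positivity
        linarith)
      (fun m hm => by
        obtain ⟨y, rfl⟩ := height_surjective hp hpq m
        rw [← hH₀, ih hw₀ (by omega) hm]) hv (height p q w) hn
    zify
    rw [hH, this]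

lemma inTerritory_of_adj {D : Set (Cyl p q)} {φ : State p q} {v w : Cyl p q}
    (hv : v ∈ D ∧ φ v = 3) (hw : w ∈ D ∧ φ w = 3) (h : (cylGraph p q).Adj v w) :
    InTerritory D φ v := by
  refine ⟨SimpleGraph.connectedComponentMk _ ⟨v, hv⟩, ⟨⟨v, hv⟩, rfl, ⟨w, hw⟩, ?_, ?_⟩, hv, rfl⟩
  · rw [SimpleGraph.ConnectedComponent.mem_supp_iff, SimpleGraph.ConnectedComponent.eq]
    exact SimpleGraph.Adj.reachable (by simpa using h.symm)
  · intro e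
    exact h.ne (congrArg Subtype.val e)

lemma lap_eq_zero_of_eq {H : ℤ → ℤ} {M m c : ℤ} (hH : ∀ x, M ≤ x → H x = c)
    (hm : M + (p + q) ≤ m) : lap p q H m = 0 := by
  unfold lap
  rw [hH _ (by omega), hH _ (by omega), hH _ (by omega), hH _ (by omega), hH _ (by omega)]
  ring

lemma exists_waves (hp : 0 < p) (hq : 0 < q) (hpq : Nat.Coprime p q)
    {S : Set (ℤ × ℤ)} (hS : S ⊆ Set.Icc (0, 0) ((p : ℤ), (q : ℤ))) {v : Cyl p q} {n : ℕ}
    (hv : (flatHeight p q (n + 1) : ℤ) ≤ height p q v) :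
    ∃ h φ, Waves (internal p q S) v n h φ := by
  induction n with
  | zero => exact ⟨_, _, rfl, rfl⟩
  | succ n ih =>
    rw [flatHeight_succ] at hv
    push_cast at hv
    obtain ⟨h, φ, hw⟩ := ih (by omega)
    rw [flatHeight_succ] at hv
    push_cast at hv
    obtain ⟨H, hH, hprof, hφ⟩ := hw.exists_isWaveProfile hp hpq
    have hflat : ∀ m, (flatHeight p q n : ℤ) ≤ m → H m = n := fun m hm => by
      obtain ⟨y, rfl⟩ := height_surjective hp hpq m
      rw [← hH, hw.eq_of_flatHeight_le hp hq hpq hS (by omega) hm]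
    have hthree : ∀ w, (flatHeight p q n + (p + q) : ℤ) ≤ height p q w →
        w ∈ internal p q S ∧ φ w = 3 := fun w hle => by
      have hD : w ∈ internal p q S := mem_internal_of_lt hp hpq hS (by
        unfold flatHeight at hle
        push_cast at hle ⊢
        have : (0 : ℤ) ≤ n * (p + q) := by positivity
        omega)
      exact ⟨hD, by rw [hφ w hD, lap_eq_zero_of_eq hflat hle, add_zero]⟩
    have hstab : StableOn (internal p q S) φ := fun w hD => by
      rw [hφ w hD]
      linarith [hprof.lap_nonpos ⟨w, hD, rfl⟩]
    have hadj : (cylGraph p q).Adj v (v + stepY p q) := by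
      rw [cylGraph, SimpleGraph.fromRel_adj]
      refine ⟨fun e => ?_, Or.inl (Or.inr rfl)⟩
      have := congrArg (height p q) e
      rw [map_add, height_stepY] at this
      omega
    have hle : ∀ w, h w ≤ n := fun w => by
      have := hprof.le_natCast (height p q w)
      rw [← hH] at this
      exact_mod_cast this
    -- Undoing the earlier topplings up to a constant restores exactly three grains at every
    -- internal site.
    obtain ⟨u, φ', hu⟩ := exists_isWave (u' := fun w => n + 1 - h w) hstab
      (inTerritory_of_adj (hthree v (by omega))
        (hthree (v + stepY p q) (by rw [map_add, height_stepY]; omega)) hadj)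
      (by show 1 ≤ n + 1 - h v; have := hle v; omega)
      (fun w hD _ => by
        have hc : ∀ y, ((n + 1 - h y : ℕ) : ℤ) = (n + 1 : ℤ) - H (height p q y) := fun y => by
          rw [Nat.cast_sub (by have := hle y; omega), ← hH]
          push_cast
          ring
        simp only [hc]
        rw [cylLap_comp_height (fun m => (n + 1 : ℤ) - H m), hφ w hD]
        unfold lap
        linarith)
    exact ⟨_, _, h, φ, u, hw, hu, rfl⟩

end WaveCylinder

/-! ### Independence of the source, the offset `k` and uniform bounds -/

namespace WaveCylinder

variable {p q : ℕ}

lemma exists_forall_ge_eq_of_monotone {a : ℕ → ℤ} (ha : Monotone a) {B : ℤ} (hB : ∀ n, a n ≤ B) :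
    ∃ N, ∀ n, N ≤ n → a n = a N := by
  obtain ⟨_, ⟨N, rfl⟩, hN⟩ := Int.exists_greatest_of_bdd (P := fun z => ∃ n, a n = z)
    ⟨B, by rintro _ ⟨n, rfl⟩; exact hB n⟩ ⟨_, 0, rfl⟩
  exact ⟨N, fun n hn => le_antisymm (hN _ ⟨n, rfl⟩) (ha hn)⟩

/-- The waves sent from far away do not depend on their source. -/
lemma exists_limit_profile (hp : 0 < p) (hq : 0 < q) (hpq : Nat.Coprime p q) {S : Set (ℤ × ℤ)}
    (hS : S ⊆ Set.Icc (0, 0) ((p : ℤ), (q : ℤ))) (n : ℕ) :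
    ∃ H : ℤ → ℤ,
      IsWaveProfile p q (height p q '' internal p q S) (flatHeight p q (n + 1)) n H ∧
      (∀ m, (flatHeight p q n : ℤ) ≤ m → H m = n) ∧
      ∀ (v : Cyl p q) (h : Cyl p q → ℕ) (φ : State p q),
        (flatHeight p q (n + 1) : ℤ) ≤ height p q v → Waves (internal p q S) v n h φ →
        (∀ w, (h w : ℤ) = H (height p q w)) ∧
        ∀ w ∈ internal p q S, φ w = 3 + lap p q H (height p q w) := by
  have key : ∀ (v : Cyl p q) (h : Cyl p q → ℕ) (φ : State p q),
      (flatHeight p q (n + 1) : ℤ) ≤ height p q v → Waves (internal p q S) v n h φ →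
      ∃ H : ℤ → ℤ, IsWaveProfile p q (height p q '' internal p q S) (height p q v) n H ∧
        (∀ m, (flatHeight p q n : ℤ) ≤ m → H m = n) ∧ (∀ w, (h w : ℤ) = H (height p q w)) ∧
        ∀ w ∈ internal p q S, φ w = 3 + lap p q H (height p q w) := by
    intro v h φ hv hw
    rw [flatHeight_succ] at hv
    push_cast at hv
    obtain ⟨H, hH, hprof, hφ⟩ := hw.exists_isWaveProfile hp hpq
    refine ⟨H, hprof, fun m hm => ?_, hH, hφ⟩
    obtain ⟨y, rfl⟩ := height_surjective hp hpq m
    rw [← hH, hw.eq_of_flatHeight_le hp hq hpq hS (by omega) hm]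
  obtain ⟨v₀, hv₀⟩ := height_surjective hp hpq (flatHeight p q (n + 1) : ℤ)
  obtain ⟨h₀, φ₀, hw₀⟩ := exists_waves hp hq hpq hS (n := n) hv₀.ge
  obtain ⟨H, hprof, hflat, -, -⟩ := key v₀ h₀ φ₀ hv₀.ge hw₀
  rw [hv₀] at hprof
  refine ⟨H, hprof, hflat, fun v h φ hv hw => ?_⟩
  obtain ⟨H', hprof', hflat', hres⟩ := key v h φ hv hw
  have hle : (flatHeight p q n : ℤ) ≤ flatHeight p q (n + 1) := by
    rw [flatHeight_succ]; push_cast; omega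
  -- Each profile already equals `n` at the source of the other.
  have heq : H' = H := funext fun m => le_antisymm
    (hprof'.le_of_le hprof (hflat _ (hle.trans hv)).ge m)
    (hprof.le_of_le hprof' (hflat' _ hle).ge m)
  rwa [heq] at hres

/-- The height form of the main result for a fixed boundary. -/
lemma exists_defect_bound (hp : 0 < p) (hq : 0 < q) (hpq : Nat.Coprime p q) {S : Set (ℤ × ℤ)}
    (hS : S ⊆ Set.Icc (0, 0) ((p : ℤ), (q : ℤ))) :
    ∃ (C : ℕ) (k : ℤ), ∀ (n : ℕ) (v : Cyl p q) (h : Cyl p q → ℕ) (φ : State p q),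
      (flatHeight p q (n + 1) : ℤ) ≤ height p q v → Waves (internal p q S) v n h φ →
      ∀ w, ((h w : ℤ) ≠ min (height p q w + k) n ∨ (w ∈ internal p q S ∧ φ w < 3)) →
        height p q w ≤ C ∨ |height p q w + k - n| ≤ C := by
  choose H hprof hflat hwaves using exists_limit_profile (p := p) (q := q) hp hq hpq hS
  set A : ℕ := p * q with hA
  set K : ℕ := A + p + q with hK
  have hlo : ∀ m ∈ height p q '' internal p q S, -(A : ℤ) ≤ m := fun m =>
    neg_le_of_mem_height_internal
  have hhi : ∀ m, (A : ℤ) < m → m ∈ height p q '' internal p q S := fun m hm => by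
    obtain ⟨y, rfl⟩ := height_surjective hp hpq m
    exact ⟨y, mem_internal_of_lt hp hpq hS hm, rfl⟩
  have hKz : (A + p + q : ℤ) ≤ K := by rw [hK]; push_cast; rfl
  have hfs : ∀ n, (flatHeight p q (n + 1) : ℤ) = flatHeight p q n + (p + q) := fun n => by
    rw [flatHeight_succ]; push_cast; rfl
  have hnK : ∀ n : ℕ, (n : ℤ) ≤ flatHeight p q (n + 1) + K := fun n => by
    have : n ≤ flatHeight p q (n + 1) := by unfold flatHeight; nlinarith
    omega
  have hgrow : ∀ n m, -(K : ℤ) ≤ m → H n m ≤ m + K := fun n m hm => by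
    have := (hprof n).le_max hlo hKz (hnK n) m
    omega
  have hgrad : ∀ n m, |H n (m + 1) - H n m| ≤ (A + 1 + K : ℕ) := fun n m => by
    push_cast
    exact (hprof n).abs_forwardDiff_le hlo hhi hKz (hnK n) (hflat n _ (by rw [hfs]; omega))
      (hflat n _ (by rw [hfs]; omega)) m
  obtain ⟨c₁, C₀, hC₀⟩ := exists_profile hp hq hpq A K (A + 1 + K)
  have hmono : Monotone fun n => H n c₁ := monotone_nat_of_le_succ fun n =>
    (hprof n).le_of_le (hprof (n + 1)) (by rw [hflat (n + 1) _ le_rfl]; push_cast; omega) c₁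
  obtain ⟨N, hN⟩ := exists_forall_ge_eq_of_monotone hmono (B := c₁ + K)
    fun n => hgrow n c₁ (by omega)
  set k : ℤ := H N c₁ - c₁ with hk
  -- Above `b n` the profile is flat and the minimum equals `n`; this covers the finitely many `n`
  -- below `max N C₀`.
  set b : ℕ → ℕ := fun n => flatHeight p q (n + 1) + (n - k).toNat with hb
  refine ⟨C₀ + ∑ n ∈ Finset.range (max N C₀), b n, k, fun n v h φ hv hw w hdef => ?_⟩
  obtain ⟨hh, hφ⟩ := hwaves n v h φ hv hw
  replace hdef : H n (height p q w) ≠ min (height p q w + k) n ∨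
      lap p q (H n) (height p q w) ≠ 0 := by
    refine hdef.imp (fun h1 => by rwa [← hh]) fun h1 h2 => ?_
    rw [hφ w h1.1, h2] at h1
    omega
  push_cast
  have hsum : (0 : ℤ) ≤ ∑ n ∈ Finset.range (max N C₀), (b n : ℤ) := by positivity
  rcases lt_or_ge n (max N C₀) with hn | hn
  · left
    have h1 : b n ≤ ∑ n ∈ Finset.range (max N C₀), b n :=
      Finset.single_le_sum (fun _ _ => Nat.zero_le _) (Finset.mem_range.mpr hn)
    zify at h1
    by_contra! hcon
    have h2 : (b n : ℤ) < height p q w := by omega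
    simp only [hb] at h2
    push_cast at h2
    rw [hfs] at h2
    rcases hdef with h3 | h3
    · exact h3 (by rw [hflat n _ (by omega)]; omega)
    · exact h3 (lap_eq_zero_of_eq (hflat n) (by omega))
  · by_cases hm : (C₀ : ℤ) ≤ height p q w
    · right
      have hkn : H n c₁ - c₁ = k := by rw [hN n ((le_max_left _ _).trans hn)]
      have := hC₀ (H n) n (hprof n).nonneg (hprof n).le_natCast (hgrow n) (hgrad n)
        (fun m hm => (hprof n).lap_nonpos (hhi m hm)) ⟨_, hflat n⟩ ((le_max_right _ _).trans hn)
        (height p q w) hm (by rwa [hkn])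
      rw [hkn] at this
      omega
    · left
      omega

lemma encard_box (p : ℕ) (a : ℤ) (c : ℕ) :
    (box p a (a + c)).encard = ((p + 1) * (c + 1) : ℕ) := by
  have : box p a (a + c) = ((Finset.Icc (0 : ℤ) p ×ˢ Finset.Icc a (a + c) : Finset (ℤ × ℤ)) :
      Set (ℤ × ℤ)) := by
    ext x
    simp only [box, Set.mem_Icc, Prod.le_def, Finset.coe_product, Finset.coe_Icc, Set.mem_prod]
    tauto
  rw [this, Set.encard_coe_eq_coe_finsetCard, Finset.card_product, Int.card_Icc, Int.card_Icc]
  congr 2; omega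

lemma box_mono {p : ℕ} {a b b' : ℤ} (h : b ≤ b') : box p a b ⊆ box p a b' :=
  Set.Icc_subset_Icc_right (Prod.mk_le_mk.mpr ⟨le_rfl, h⟩)

lemma mem_box_zero_of_le (hp : 0 < p) {x : ℤ × ℤ} (hx : x ∈ strip p) {C : ℕ}
    (h : p * x.2 - q * x.1 ≤ C) : x ∈ box p 0 ((C + p * q : ℕ) : ℤ) := by
  obtain ⟨h1, h2, h3⟩ := hx
  have hp' : (1 : ℤ) ≤ p := by exact_mod_cast hp
  have hq' : (0 : ℤ) ≤ q := by positivity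
  refine ⟨⟨h1, h3⟩, h2, ?_⟩
  push_cast
  show x.2 ≤ _
  nlinarith

lemma mem_box_of_mem_band (hp : 0 < p) {x : ℤ × ℤ} (hx : x ∈ strip p) {C n : ℕ} {k : ℤ}
    (h : |p * x.2 - q * x.1 + k - n| ≤ C) :
    x ∈ box p ((n - k - C) / p) ((n - k - C) / p + (2 * C + p * q + 1 : ℕ)) := by
  obtain ⟨h1, h2, h3⟩ := hx
  have hp' : (1 : ℤ) ≤ p := by exact_mod_cast hp
  have hq' : (0 : ℤ) ≤ q := by positivity
  rw [abs_le] at h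
  have e1 := Int.emod_add_mul_ediv (n - k - C) p
  have e2 := Int.emod_nonneg (n - k - C) (b := (p : ℤ)) (by omega)
  have e3 := Int.emod_lt_of_pos (n - k - C) (b := (p : ℤ)) (by omega)
  set a : ℤ := (n - k - C) / p
  have h4 : 0 ≤ q * x.1 := by positivity
  have h5 : q * x.1 ≤ p * q := by nlinarith
  refine ⟨⟨h1, ?_⟩, h2, ?_⟩
  · show a ≤ x.2
    by_contra! hcon
    nlinarith
  · push_cast
    show x.2 ≤ _
    by_contra! hcon
    have h6 : 0 ≤ (2 * C + p * q : ℤ) := by positivity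
    nlinarith

end WaveCylinder

open WaveCylinder

theorem mainTheorem6 (p q : ℕ) (hp : 0 < p) (hq : 0 < q) (hpq : Nat.Coprime p q) :
    ∃ C : ℕ, ∀ S : Set (ℤ × ℤ), S ⊆ Set.Icc (0, 0) ((p : ℤ), (q : ℤ)) →
      ∃ k : ℤ, ∀ n : ℕ, ∃ N₀ : ℤ, ∀ i₀ N : ℤ, 0 ≤ i₀ → i₀ ≤ p → N₀ ≤ N →
        (∃ (h : WaveCylinder.Cyl p q → ℕ) (φ : WaveCylinder.State p q),
          WaveCylinder.Waves (WaveCylinder.internal p q S) (WaveCylinder.site p q (i₀, N))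
            n h φ) ∧
        ∀ (h : WaveCylinder.Cyl p q → ℕ) (φ : WaveCylinder.State p q),
          WaveCylinder.Waves (WaveCylinder.internal p q S) (WaveCylinder.site p q (i₀, N))
            n h φ →
          (WaveCylinder.defectSet p q h k n).encard < C ∧
          ∃ (a : ℤ) (B E : Set (ℤ × ℤ)),
            WaveCylinder.defectSet p q h k n = B ∪ E ∧
            B ⊆ WaveCylinder.box p 0 C ∧
            E ⊆ WaveCylinder.box p a (a + C) ∩ WaveCylinder.band p q k n C ∧
            WaveCylinder.coloredSet p q (WaveCylinder.internal p q S) φ ⊆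
              WaveCylinder.box p 0 C ∪
                (WaveCylinder.box p a (a + C) ∩ WaveCylinder.band p q k n C) := by
  -- Finitely many boundaries, hence one constant for all of them.
  have hfin : {S : Set (ℤ × ℤ) | S ⊆ Set.Icc (0, 0) ((p : ℤ), (q : ℤ))}.Finite :=
    (Set.finite_Icc _ _).finite_subsets
  have hex : ∀ S : Set (ℤ × ℤ), ∃ C : ℕ, S ⊆ Set.Icc (0, 0) ((p : ℤ), (q : ℤ)) →
      ∃ k : ℤ, ∀ (n : ℕ) (v : Cyl p q) (h : Cyl p q → ℕ) (φ : State p q),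
      (flatHeight p q (n + 1) : ℤ) ≤ height p q v → Waves (internal p q S) v n h φ →
      ∀ w, ((h w : ℤ) ≠ min (height p q w + k) n ∨ (w ∈ internal p q S ∧ φ w < 3)) →
        height p q w ≤ C ∨ |height p q w + k - n| ≤ C := fun S => by
    by_cases hS : S ⊆ Set.Icc (0, 0) ((p : ℤ), (q : ℤ))
    · obtain ⟨C, hC⟩ := exists_defect_bound hp hq hpq hS
      exact ⟨C, fun _ => hC⟩
    · exact ⟨0, fun h => absurd h hS⟩
  choose f hf using hex
  obtain ⟨C, hC⟩ := (hfin.image f).bddAbove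
  have hp' : (1 : ℤ) ≤ p := by exact_mod_cast hp
  -- `C₁` is the height of both boxes, with `p * q` allowing for the variation of `q * i` across the
  -- strip; `C₂` exceeds the number of lattice points in the two boxes together.
  set C₁ : ℕ := 2 * C + p * q + 1 with hC₁
  have hCC : C ≤ C₁ := by omega
  set C₂ : ℕ := 2 * ((p + 1) * (C₁ + 1)) + 1 with hC₂
  have hCC₂ : C₁ ≤ C₂ := by nlinarith
  refine ⟨C₂, fun S hS => ?_⟩
  obtain ⟨k, hk⟩ := hf S hS
  have hSC : f S ≤ C := hC ⟨S, hS, rfl⟩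
  refine ⟨k, fun n => ⟨flatHeight p q (n + 1) + q * p, fun i₀ N hi₀ hi₀p hN => ?_⟩⟩
  have hv : (flatHeight p q (n + 1) : ℤ) ≤ height p q (site p q (i₀, N)) := by
    rw [height_site]
    have h1 : (q : ℤ) * i₀ ≤ q * p := by gcongr
    have h2 : (0 : ℤ) ≤ N := le_trans (by positivity) hN
    simp only
    nlinarith
  refine ⟨exists_waves hp hq hpq hS hv, fun h φ hw => ?_⟩
  have hreg : ∀ x ∈ strip p, ((h (site p q x) : ℤ) ≠ min (p * x.2 - q * x.1 + k) n ∨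
      (site p q x ∈ internal p q S ∧ φ (site p q x) < 3)) →
      x ∈ box p 0 C₁ ∨ (x ∈ box p ((n - k - C) / p) ((n - k - C) / p + C₁) ∧
        x ∈ band p q k n C₂) := by
    intro x hx hdef
    have := hk n _ h φ hv hw (site p q x)
    rw [height_site] at this
    rcases this hdef with h1 | h1
    · left
      exact box_mono (by omega) (mem_box_zero_of_le (q := q) (C := C) hp hx (by omega))
    · right
      exact ⟨mem_box_of_mem_band hp hx (by omega), h1.trans (by omega)⟩
  refine ⟨?_, (n - k - C) / p, defectSet p q h k n ∩ box p 0 C₁,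
    defectSet p q h k n ∩ (box p ((n - k - C) / p) ((n - k - C) / p + C₁) ∩ band p q k n C₂),
    ?_, ?_, ?_, ?_⟩
  · calc (defectSet p q h k n).encard
        ≤ (box p 0 (0 + C₁) ∪ box p ((n - k - C) / p) ((n - k - C) / p + C₁)).encard := by
          refine Set.encard_le_encard fun x hx => ?_
          rw [zero_add]
          exact (hreg x hx.1 (Or.inl hx.2)).imp id And.left
      _ ≤ _ := Set.encard_union_le _ _
      _ < C₂ := by
          rw [encard_box, encard_box]
          norm_cast
          omega
  · ext x
    refine ⟨fun hx => ?_, fun hx => hx.elim And.left And.left⟩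
    exact (hreg x hx.1 (Or.inl hx.2)).imp (fun h1 => ⟨hx, h1⟩) fun h1 => ⟨hx, h1⟩
  · exact Set.inter_subset_right.trans (box_mono (by omega))
  · exact Set.inter_subset_right.trans (Set.inter_subset_inter_left _ (box_mono (by omega)))
  · intro x hx
    exact (hreg x hx.1 (Or.inr hx.2)).imp (fun h1 => box_mono (by omega) h1)
      fun h1 => ⟨box_mono (by omega) h1.1, h1.2⟩
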